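/- Let $m_0,m_1,m_2\in\mathbb{R}^2$ be non-collinear points (microphones). Write $d_i(x)=\lVert x-m_i\rVert$, $\mathbf d_{ji}=m_j-m_i$, $d_{ji}=\lVert\mathbf d_{ji}\rVert$, and let the TDOA map be $$\tau_2:\mathbb{R}^2\to\mathbb{R}^2,\qquad \tau_2(x)=(d_1(x)-d_0(x),\,d_2(x)-d_0(x)).$$ For $\tau=(\tau_1,\tau_2)\in\mathbb{R}^2$ put $\tau_0=0$ and $Q_{ji}(\tau)=d_{ji}^2-(\tau_j-\tau_i)^2$, and let $P_2=\{\tau: Q_{ji}(\tau)\ge 0,\ 0\le i<j\le 2\}$. Let $\lVert \mathbf d_{10}\wedge \mathbf d_{20}\rVert=|\det(\mathbf d_{10},\mathbf d_{20})|$ and $$a(\tau)=\lVert \tau_2\mathbf d_{10}-\tau_1\mathbf d_{20}\rVert^2-\lVert \mathbf d_{10}\wedge \mathbf d_{20}\rVert^2,\qquad b(\tau)=\frac{\langle \tau_2\mathbf d_{10}-\tau_1\mathbf d_{20},\;Q_{20}(\tau)\mathbf d_{10}-Q_{10}(\tau)\mathbf d_{20}\rangle}{2\lVert \mathbf d_{10}\wedge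 \mathbf d_{20}\rVert}.$$ Let $E^-=\{a<0\}$ (the interior of the ellipse $a=0$), $E^+=\{a>0\}$ and $C^+=\{b>0\}$. Let $$R^0=(d_{10},d_{20}),\quad R^1=(-d_{10},\,d_{21}-d_{10}),\quad R^2=(d_{21}-d_{20},\,-d_{20}),$$ and for $\{i,j,k\}=\{0,1,2\}$ with $k<j$ let $$T_i^{\pm}=\pm\left(\frac{\langle \mathbf d_{10},\mathbf d_{jk}\rangle}{d_{jk}},\ \frac{\langle \mathbf d_{20},\mathbf d_{jk}\rangle}{d_{jk}}\right).$$ Then the set $\operatorname{int}(P_2)\cap E^+\cap C^+$ has exactly three connected components, and they can be named $U_0,U_1,U_2$ in exactly one way such that $R^i\in\overline{U_i}$ for $i=0,1,2$. With this naming, $$\operatorname{Im}(\tau_2)=\bigl(E^-\cup\overline{U_0}\cup\overline{U_1}\cup\overline{U_2}\bigr)\setminus\{T_0^\pm,T_1^\pm,T_2^\pm\},$$ and $$|\tau_2^{-1}(\tau)|=\begin{cases}2 & \text{if }\tau\in U_0\cup U_1\cup U_2,\\ 1 & \text{if }\tau\in\operatorname{Im}(\tau_2)\setminus(U_0\cup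 U_1\cup U_2).\end{cases}$$ -/

import Mathlib

noncomputable section

namespace TDOA

/-- The physical plane (`x`-plane) with its Euclidean structure. -/
abbrev Plane : Type := EuclideanSpace ℝ (Fin 2)

/-- The displacement vector `d_{ji} = m_j - m_i` between two microphones. -/
def disp (m : Fin 3 → Plane) (j i : Fin 3) : Plane := m j - m i

/-- The TDOA map (speed of propagation `1`, reference microphone `m 0`):
`x ↦ (d_1(x) - d_0(x), d_2(x) - d_0(x))`, where `d_i(x) = |x - m_i|`. -/
def tdoaMap (m : Fin 3 → Plane) (x : Plane) : ℝ × ℝ :=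
  (‖x - m 1‖ - ‖x - m 0‖, ‖x - m 2‖ - ‖x - m 0‖)

/-- The height of the `i`-th lifted point `M_i(τ)`: `0`, `τ_1`, `τ_2`. -/
def height (τ : ℝ × ℝ) : Fin 3 → ℝ := ![0, τ.1, τ.2]

/-- The Minkowski square `‖D_{ji}(τ)‖²` of
`D_{ji}(τ) = M_j(τ) - M_i(τ) = (d_{ji}, τ_j - τ_i)` in `ℝ^{2,1}`. -/
def minkSq (m : Fin 3 → Plane) (τ : ℝ × ℝ) (j i : Fin 3) : ℝ :=
  ‖disp m j i‖ ^ 2 - (height τ j - height τ i) ^ 2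

/-- The polygon `P_2`. -/
def polygon (m : Fin 3 → Plane) : Set (ℝ × ℝ) :=
  {τ | ∀ i j : Fin 3, i < j → 0 ≤ minkSq m τ j i}

/-- `‖u ∧ v‖` for two vectors of the Euclidean plane: the absolute value of their determinant. -/
def wedgeNorm (u v : Plane) : ℝ := |u 0 * v 1 - u 1 * v 0|

/-- The quadratic polynomial `a(τ) = ‖τ_2 d_{10} - τ_1 d_{20}‖² - ‖d_{10} ∧ d_{20}‖²`. -/
def coeffA (m : Fin 3 → Plane) (τ : ℝ × ℝ) : ℝ :=
  ‖τ.2 • disp m 1 0 - τ.1 • disp m 2 0‖ ^ 2 - wedgeNorm (disp m 1 0) (disp m 2 0) ^ 2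

/-- The cubic polynomial
`b(τ) = ⟨τ_2 d_{10} - τ_1 d_{20}, ‖D_{20}(τ)‖² d_{10} - ‖D_{10}(τ)‖² d_{20}⟩
  / (2 ‖d_{10} ∧ d_{20}‖)`. -/
def coeffB (m : Fin 3 → Plane) (τ : ℝ × ℝ) : ℝ :=
  inner ℝ (τ.2 • disp m 1 0 - τ.1 • disp m 2 0)
      (minkSq m τ 2 0 • disp m 1 0 - minkSq m τ 1 0 • disp m 2 0) /
    (2 * wedgeNorm (disp m 1 0) (disp m 2 0))

/-- `E⁻ = {a < 0}`, the interior of the ellipse `a = 0`. -/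
def ellipseMinus (m : Fin 3 → Plane) : Set (ℝ × ℝ) := {τ | coeffA m τ < 0}

/-- `E⁺ = {a > 0}`, the exterior of the ellipse `a = 0`. -/
def ellipsePlus (m : Fin 3 → Plane) : Set (ℝ × ℝ) := {τ | 0 < coeffA m τ}

/-- `C⁺ = {b > 0}`. -/
def cubicPlus (m : Fin 3 → Plane) : Set (ℝ × ℝ) := {τ | 0 < coeffB m τ}

/-- The three vertices `R^0 = (d_{10}, d_{20})`, `R^1 = (-d_{10}, d_{21} - d_{10})`,
`R^2 = (d_{21} - d_{20}, -d_{20})` of the polygon. -/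
def vertex (m : Fin 3 → Plane) : Fin 3 → ℝ × ℝ :=
  ![(‖disp m 1 0‖, ‖disp m 2 0‖),
    (-‖disp m 1 0‖, ‖disp m 2 1‖ - ‖disp m 1 0‖),
    (‖disp m 2 1‖ - ‖disp m 2 0‖, -‖disp m 2 0‖)]

/-- `(⟨d_{10}, u⟩, ⟨d_{20}, u⟩)`, where `u` is the unit vector of `d_{jk}`. -/
def tangencyAlong (m : Fin 3 → Plane) (j k : Fin 3) : ℝ × ℝ :=
  (inner ℝ (disp m 1 0) (‖disp m j k‖⁻¹ • disp m j k),
    inner ℝ (disp m 2 0) (‖disp m j k‖⁻¹ • disp m j k))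

/-- The points `T_0^+, T_1^+, T_2^+`: `T_i^+` is taken along `d_{jk}` with `{i, j, k} = {0, 1, 2}`
and `k < j`. -/
def tangencyPlus (m : Fin 3 → Plane) : Fin 3 → ℝ × ℝ :=
  ![tangencyAlong m 2 1, tangencyAlong m 2 0, tangencyAlong m 1 0]

/-- The six tangency points `T_i^±`, with `T_i^- = -T_i^+`. -/
def tangencyPoints (m : Fin 3 → Plane) : Set (ℝ × ℝ) :=
  {τ | ∃ i : Fin 3, τ = tangencyPlus m i ∨ τ = -tangencyPlus m i}

/-- The set of connected components of a subset `S` of the `τ`-plane. -/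
def components (S : Set (ℝ × ℝ)) : Set (Set (ℝ × ℝ)) :=
  {W | ∃ τ ∈ S, W = connectedComponentIn S τ}

/-- The open set `int(P_2) ∩ E⁺ ∩ C⁺`. -/
def ambiguous (m : Fin 3 → Plane) : Set (ℝ × ℝ) :=
  interior (polygon m) ∩ ellipsePlus m ∩ cubicPlus m

/-- `U 0, U 1, U 2` are pairwise distinct, they are exactly the connected components of
`int(P_2) ∩ E⁺ ∩ C⁺`, and `R^i` lies in the closure of `U i`. -/
structure IsComponentLabelling (m : Fin 3 → Plane) (U : Fin 3 → Set (ℝ × ℝ)) : Prop where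
  injective : Function.Injective U
  range_eq : Set.range U = components (ambiguous m)
  vertex_mem : ∀ i, vertex m i ∈ closure (U i)

end TDOA

end

/-!
The proof rests on a linear change of coordinates in the `τ`-plane. Let `w = dual m τ` be the vector
of the physical plane with `⟪w, mⱼ - mᵢ⟫ = τⱼ - τᵢ`. Then `a(τ) = D² (‖w‖² - 1)` with
`D = det (d₁₀, d₂₀)`, so the ellipse becomes the unit circle (`coeffA_eq`); the polygon `P₂` becomes
the hexagon `|⟪w, mⱼ - mᵢ⟫| ≤ ‖mⱼ - mᵢ‖` circumscribed about that circle (`mem_polygon_iff`), and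
the points `T_i^±` become the unit vectors of the edges, where its sides touch the circle
(`mem_tangencyPoints_iff`). In these coordinates all microphones play the same role.

Write `w = ∑ cₗ mₗ` with `∑ cₗ = 0` (`weight`). Of three numbers with sum zero, two are positive, or
two are negative, or one vanishes. Hence the hexagon outside the open disc consists of three corners
`cᵢ₊₁, cᵢ₊₂ > 0`, which contain the vertices `Rⁱ`, of their opposites, and of the points of tangency
(`mem_hexagon_cases`). In the coordinates given by the two unit normals, a corner outside the circle
is an upper set in a product of two half-lines, hence connected (`isPreconnected_cornerSet`).

A source at distance `r` from `m₀` is `x = m₀ + q - r w` with `q = foot m τ`, where `r` is a root of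
`(‖w‖² - 1) r² - 2 ⟪q, w⟫ r + ‖q‖² = 0` (`isSignedSource_iff`) and all `r + τₗ` are nonnegative.
The coefficient `⟪q, w⟫` has the sign of `b` (`coeffB_eq`), and the discriminant is a positive
multiple of `Q₁₀ Q₂₀ Q₂₁` (`discriminant_eq`). Which roots are admissible is decided by signs. In
the open hexagon all signed distances `r + τₗ` have the same sign, by the triangle inequality. In a
corner every root is admissible, by the Cauchy-Schwarz inequality
(`IsSignedSource.nonneg_of_mem_closedCorner`); by the symmetry `(τ, r) ↦ (-τ, -r)` none is
admissible in the opposite corners, and at the points of tangency there are no roots at all. So `b`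
is positive exactly on the three corners (`ambiguous_eq_iUnion`), which are therefore the connected
components, and the fibres have as many points as there are roots: two in the open corners, one on
their sides (double root) and on their arcs (linear equation), and one inside the disc, where the
two roots have opposite signs.
-/

noncomputable section

namespace TDOA

/-! ### The Euclidean plane in coordinates -/

/-- The determinant of two vectors of the Euclidean plane. -/
def cross (u v : Plane) : ℝ := u 0 * v 1 - u 1 * v 0

lemma inner_eq_coord (u v : Plane) : inner ℝ u v = u 0 * v 0 + u 1 * v 1 := by
  simp [PiLp.inner_apply, Fin.sum_univ_two, mul_comm]

lemma norm_sq_eq_coord (u : Plane) : ‖u‖ ^ 2 = u 0 ^ 2 + u 1 ^ 2 := by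
  simp [EuclideanSpace.norm_sq_eq, Fin.sum_univ_two]

lemma lagrange_identity (u v : Plane) :
    cross u v ^ 2 + inner ℝ u v ^ 2 = ‖u‖ ^ 2 * ‖v‖ ^ 2 := by
  rw [inner_eq_coord, norm_sq_eq_coord, norm_sq_eq_coord, cross]; ring

lemma exists_eq_smul_of_cross_eq_zero {u v : Plane} (h : cross u v = 0) (hu : u ≠ 0) :
    ∃ t : ℝ, v = t • u := by
  refine ⟨inner ℝ u v / ‖u‖ ^ 2, ?_⟩
  have hn : u 0 ^ 2 + u 1 ^ 2 ≠ 0 := by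
    rw [← norm_sq_eq_coord]; exact pow_ne_zero _ (norm_ne_zero_iff.2 hu)
  rw [cross] at h
  rw [inner_eq_coord, norm_sq_eq_coord]
  ext k
  fin_cases k <;> simp <;> field_simp <;> [linear_combination -u 1 * h; linear_combination u 0 * h]

lemma abs_inner_lt_of_cross_ne_zero {u v : Plane} (h : cross u v ≠ 0) :
    |inner ℝ u v| < ‖u‖ * ‖v‖ := by
  refine abs_lt_of_sq_lt_sq ?_ (by positivity)
  have := lagrange_identity u v
  have h2 : 0 < cross u v ^ 2 := by positivity
  rw [mul_pow]; linarith

lemma ne_zero_of_cross_ne_zero {u v : Plane} (h : cross u v ≠ 0) : u ≠ 0 ∧ v ≠ 0 := by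
  constructor <;> rintro rfl <;> simp [cross] at h

/-! ### The dual coordinate of a pair of range differences -/

/-- The oriented area `det (d₁₀, d₂₀)` spanned by the microphones. -/
def area (m : Fin 3 → Plane) : ℝ := cross (m 1 - m 0) (m 2 - m 0)

lemma area_ne_zero {m : Fin 3 → Plane} (hm : ¬ Collinear ℝ (Set.range m)) : area m ≠ 0 := by
  intro h
  apply hm
  rw [collinear_iff_of_mem (p₀ := m 0) (Set.mem_range_self 0)]
  by_cases hu : m 1 - m 0 = 0
  · refine ⟨m 2 - m 0, ?_⟩
    rintro _ ⟨l, rfl⟩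
    fin_cases l
    · exact ⟨0, by simp⟩
    · exact ⟨0, by simpa using sub_eq_zero.1 hu⟩
    · exact ⟨1, by simp⟩
  · obtain ⟨t, ht⟩ := exists_eq_smul_of_cross_eq_zero h hu
    refine ⟨m 1 - m 0, ?_⟩
    rintro _ ⟨l, rfl⟩
    fin_cases l
    · exact ⟨0, by simp⟩
    · exact ⟨1, by simp⟩
    · exact ⟨t, by simp [← ht]⟩

lemma cross_edges (m : Fin 3 → Plane) (i : Fin 3) :
    cross (m (i + 1) - m i) (m (i + 2) - m i) = area m := by
  fin_cases i <;> simp [cross, area] <;> ring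

lemma edge_norm_pos {m : Fin 3 → Plane} (hD : area m ≠ 0) {i j : Fin 3} (hij : i ≠ j) :
    0 < ‖m j - m i‖ := by
  rw [norm_pos_iff, sub_ne_zero]
  intro h
  apply hD
  rw [area, cross]
  fin_cases i <;> fin_cases j <;> simp_all
  all_goals ring

/-- The vector `w` of the plane whose inner products with `d₁₀` and `d₂₀` are `τ₁` and `τ₂`. -/
def dual (m : Fin 3 → Plane) (τ : ℝ × ℝ) : Plane :=
  (area m)⁻¹ • !₂[τ.1 * (m 2 - m 0) 1 - τ.2 * (m 1 - m 0) 1,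
    τ.2 * (m 1 - m 0) 0 - τ.1 * (m 2 - m 0) 0]

lemma continuous_dual (m : Fin 3 → Plane) : Continuous (dual m) := by
  have h : Continuous fun τ : ℝ × ℝ => ![τ.1 * (m 2 - m 0) 1 - τ.2 * (m 1 - m 0) 1,
      τ.2 * (m 1 - m 0) 0 - τ.1 * (m 2 - m 0) 0] := by
    refine continuous_pi fun k => ?_
    fin_cases k <;> simp <;> fun_prop
  have h' := (PiLp.continuous_toLp 2 (fun _ : Fin 2 => ℝ)).comp h
  exact h'.const_smul (area m)⁻¹

lemma dual_smul (m : Fin 3 → Plane) (t : ℝ) (τ : ℝ × ℝ) : dual m (t • τ) = t • dual m τ := by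
  ext k; fin_cases k <;> simp [dual] <;> ring

lemma inner_dual {m : Fin 3 → Plane} (hD : area m ≠ 0) (τ : ℝ × ℝ) (i j : Fin 3) :
    inner ℝ (dual m τ) (m j - m i) = height τ j - height τ i := by
  rw [inner_eq_coord]
  have h : (m 1 0 - m 0 0) * (m 2 1 - m 0 1) - (m 1 1 - m 0 1) * (m 2 0 - m 0 0) ≠ 0 := by
    simpa [area, cross] using hD
  fin_cases i <;> fin_cases j <;> simp [dual, height, area, cross] <;> field_simp <;> ring

/-- A vector is the dual coordinate of its own inner products with the edges. -/
lemma dual_inner {m : Fin 3 → Plane} (hD : area m ≠ 0) (w : Plane) :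
    dual m (inner ℝ w (m 1 - m 0), inner ℝ w (m 2 - m 0)) = w := by
  rw [inner_eq_coord, inner_eq_coord]
  have h : (m 1 0 - m 0 0) * (m 2 1 - m 0 1) - (m 1 1 - m 0 1) * (m 2 0 - m 0 0) ≠ 0 := by
    simpa [area, cross] using hD
  ext k
  fin_cases k <;> simp [dual, area, cross] <;> field_simp <;> ring

lemma dual_injective {m : Fin 3 → Plane} (hD : area m ≠ 0) : Function.Injective (dual m) := by
  intro σ τ h
  have h1 := inner_dual hD σ 0 1
  have h2 := inner_dual hD σ 0 2
  rw [h, inner_dual hD] at h1 h2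
  simp [height] at h1 h2
  exact Prod.ext h1.symm h2.symm

/-- Plane vectors are determined by their inner products with two independent edges. -/
lemma eq_of_inner_edges_eq {m : Fin 3 → Plane} (hD : area m ≠ 0) {v w : Plane}
    (h1 : inner ℝ v (m 1 - m 0) = inner ℝ w (m 1 - m 0))
    (h2 : inner ℝ v (m 2 - m 0) = inner ℝ w (m 2 - m 0)) : v = w := by
  rw [← dual_inner hD v, ← dual_inner hD w, h1, h2]

/-- The `l`-th coefficient of a plane vector `w` written as an affine combination
`∑ cₗ mₗ` of the microphones with `∑ cₗ = 0`. -/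
def weight (m : Fin 3 → Plane) (l : Fin 3) (w : Plane) : ℝ :=
  cross w (m (l + 1) - m (l + 2)) / area m

lemma continuous_weight (m : Fin 3 → Plane) (l : Fin 3) : Continuous (weight m l) := by
  unfold weight cross
  fun_prop

lemma weight_smul (m : Fin 3 → Plane) (l : Fin 3) (t : ℝ) (w : Plane) :
    weight m l (t • w) = t * weight m l w := by
  simp [weight, cross]; ring

lemma weight_neg (m : Fin 3 → Plane) (l : Fin 3) (w : Plane) :
    weight m l (-w) = -weight m l w := by
  simpa using weight_smul m l (-1) w

lemma weight_sum (m : Fin 3 → Plane) (i : Fin 3) (w : Plane) :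
    weight m i w + weight m (i + 1) w + weight m (i + 2) w = 0 := by
  fin_cases i <;> simp [weight, cross] <;> ring

lemma eq_weight_smul_add {m : Fin 3 → Plane} (hD : area m ≠ 0) (i : Fin 3) (w : Plane) :
    w = weight m (i + 1) w • (m (i + 1) - m i) + weight m (i + 2) w • (m (i + 2) - m i) := by
  have key : ∀ k, area m * w k =
      cross w (m (i + 1 + 1) - m (i + 1 + 2)) * (m (i + 1) - m i) k +
        cross w (m (i + 2 + 1) - m (i + 2 + 2)) * (m (i + 2) - m i) k := by
    intro k
    fin_cases i <;> fin_cases k <;> simp [area, cross] <;> ring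
  ext k
  rw [PiLp.add_apply, PiLp.smul_apply, PiLp.smul_apply, smul_eq_mul, smul_eq_mul, weight, weight]
  field_simp
  exact (mul_comm _ _).trans (key k)

/-- The dual coordinate turns the ellipse `a = 0` into the unit circle. -/
lemma coeffA_eq {m : Fin 3 → Plane} (hD : area m ≠ 0) (τ : ℝ × ℝ) :
    coeffA m τ = area m ^ 2 * (‖dual m τ‖ ^ 2 - 1) := by
  have h1 := inner_dual hD τ 0 1
  have h2 := inner_dual hD τ 0 2
  simp only [height, Matrix.cons_val_zero, Matrix.cons_val_one, Matrix.cons_val, sub_zero] at h1 h2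
  rw [coeffA, wedgeNorm, sq_abs, ← h1, ← h2, norm_sq_eq_coord, norm_sq_eq_coord, inner_eq_coord,
    inner_eq_coord]
  simp [disp, area, cross]; ring

/-! ### The hexagon circumscribed about the unit circle -/

/-- The image of `P₂` in the dual plane: the hexagon whose sides are tangent to the unit circle at
the unit vectors of the edges. -/
def hexagon (m : Fin 3 → Plane) : Set Plane :=
  {w | ∀ i j, |inner ℝ w (m j - m i)| ≤ ‖m j - m i‖}

/-- The interior of the hexagon. -/
def openHexagon (m : Fin 3 → Plane) : Set Plane :=
  {w | ∀ i j, i ≠ j → |inner ℝ w (m j - m i)| < ‖m j - m i‖}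

lemma openHexagon_subset (m : Fin 3 → Plane) : openHexagon m ⊆ hexagon m := by
  intro w hw i j
  rcases eq_or_ne i j with rfl | h
  · simp
  · exact (hw i j h).le

lemma isClosed_hexagon (m : Fin 3 → Plane) : IsClosed (hexagon m) := by
  have : hexagon m = ⋂ i, ⋂ j, {w | |inner ℝ w (m j - m i)| ≤ ‖m j - m i‖} := by
    ext w; simp [hexagon]
  rw [this]
  refine isClosed_iInter fun i => isClosed_iInter fun j => isClosed_le ?_ continuous_const
  fun_prop

lemma isOpen_openHexagon (m : Fin 3 → Plane) : IsOpen (openHexagon m) := by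
  have : openHexagon m =
      ⋂ i, ⋂ j, ⋂ _ : i ≠ j, {w | |inner ℝ w (m j - m i)| < ‖m j - m i‖} := by
    ext w; simp [openHexagon]
  rw [this]
  refine isOpen_iInter_of_finite fun i => isOpen_iInter_of_finite fun j =>
    isOpen_iInter_of_finite fun _ => isOpen_lt ?_ continuous_const
  fun_prop

lemma smul_mem_openHexagon {m : Fin 3 → Plane} (hD : area m ≠ 0) {w : Plane} (hw : w ∈ hexagon m)
    {t : ℝ} (h0 : 0 ≤ t) (h1 : t < 1) : t • w ∈ openHexagon m := by
  intro i j hij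
  rw [real_inner_smul_left, abs_mul, abs_of_nonneg h0]
  nlinarith [hw i j, edge_norm_pos hD hij, abs_nonneg (inner ℝ w (m j - m i))]

lemma neg_mem_hexagon {m : Fin 3 → Plane} {w : Plane} (hw : w ∈ hexagon m) : -w ∈ hexagon m := by
  intro i j
  rw [inner_neg_left, abs_neg]; exact hw i j

lemma mem_openHexagon_of_norm_lt_one {m : Fin 3 → Plane} (hD : area m ≠ 0) {w : Plane}
    (hw : ‖w‖ < 1) : w ∈ openHexagon m := by
  intro i j hij
  have := abs_real_inner_le_norm w (m j - m i)
  nlinarith [edge_norm_pos hD hij]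

lemma abs_inner_sub_comm (w a b : Plane) : |inner ℝ w (a - b)| = |inner ℝ w (b - a)| := by
  rw [← abs_neg, ← inner_neg_right, neg_sub]

/-- Three sides of the hexagon, one for each edge, determine the open hexagon by symmetry. -/
lemma mem_openHexagon_of_frame {m : Fin 3 → Plane} {w : Plane} (i : Fin 3)
    (h1 : |inner ℝ w (m (i + 1) - m i)| < ‖m (i + 1) - m i‖)
    (h2 : |inner ℝ w (m (i + 2) - m i)| < ‖m (i + 2) - m i‖)
    (h3 : |inner ℝ w (m (i + 2) - m (i + 1))| < ‖m (i + 2) - m (i + 1)‖) :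
    w ∈ openHexagon m := by
  have h1' := h1
  have h2' := h2
  have h3' := h3
  rw [abs_inner_sub_comm, norm_sub_rev] at h1' h2' h3'
  intro k l hkl
  fin_cases i <;> fin_cases k <;> fin_cases l <;> first | exact absurd rfl hkl | assumption

lemma mem_hexagon_of_frame {m : Fin 3 → Plane} {w : Plane} (i : Fin 3)
    (h1 : |inner ℝ w (m (i + 1) - m i)| ≤ ‖m (i + 1) - m i‖)
    (h2 : |inner ℝ w (m (i + 2) - m i)| ≤ ‖m (i + 2) - m i‖)
    (h3 : |inner ℝ w (m (i + 2) - m (i + 1))| ≤ ‖m (i + 2) - m (i + 1)‖) :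
    w ∈ hexagon m := by
  have h1' := h1
  have h2' := h2
  have h3' := h3
  rw [abs_inner_sub_comm, norm_sub_rev] at h1' h2' h3'
  intro k l
  rcases eq_or_ne k l with rfl | hkl
  · simp
  fin_cases i <;> fin_cases k <;> fin_cases l <;> first | exact absurd rfl hkl | assumption

lemma mem_polygon_iff {m : Fin 3 → Plane} (hD : area m ≠ 0) {τ : ℝ × ℝ} :
    τ ∈ polygon m ↔ dual m τ ∈ hexagon m := by
  have key : ∀ i j, 0 ≤ minkSq m τ j i ↔ |inner ℝ (dual m τ) (m j - m i)| ≤ ‖m j - m i‖ := by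
    intro i j
    rw [minkSq, ← inner_dual hD, disp, sub_nonneg, sq_le_sq, abs_of_nonneg (norm_nonneg _)]
  constructor
  · intro h i j
    rcases lt_trichotomy i j with hij | rfl | hij
    · exact (key i j).1 (h i j hij)
    · simp
    · have := (key j i).1 (h j i hij)
      rwa [← neg_sub, inner_neg_right, abs_neg, norm_neg]
  · intro h i j _
    exact (key i j).2 (h i j)

lemma mem_interior_polygon_iff {m : Fin 3 → Plane} (hD : area m ≠ 0) {τ : ℝ × ℝ} :
    τ ∈ interior (polygon m) ↔ dual m τ ∈ openHexagon m := by
  constructor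
  · intro h i j hij
    -- a slight dilation of an interior point stays in the polygon
    have hc : Filter.Tendsto (fun t : ℝ => t • τ) (nhdsWithin 1 (Set.Ioi 1)) (nhds τ) := by
      have : Continuous fun t : ℝ => t • τ := by fun_prop
      simpa using (this.tendsto 1).mono_left nhdsWithin_le_nhds
    obtain ⟨t, ht, (ht1 : 1 < t)⟩ :=
      ((hc.eventually (isOpen_interior.mem_nhds h)).and self_mem_nhdsWithin).exists
    have ht' := (mem_polygon_iff hD).1 (interior_subset ht) i j
    rw [dual_smul, real_inner_smul_left, abs_mul, abs_of_pos (by linarith)] at ht'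
    nlinarith [edge_norm_pos hD hij, abs_nonneg (inner ℝ (dual m τ) (m j - m i))]
  · intro h
    refine mem_interior.2 ⟨dual m ⁻¹' openHexagon m, fun σ hσ => ?_,
      (isOpen_openHexagon m).preimage (continuous_dual m), h⟩
    exact (mem_polygon_iff hD).2 (openHexagon_subset m hσ)

/-! ### Corners between two tangent lines of the circle -/

/-- The cosine of the angle between two vectors. -/
def cosine (a b : Plane) : ℝ := inner ℝ a b / (‖a‖ * ‖b‖)

lemma abs_cosine_lt_one {a b : Plane} (h : cross a b ≠ 0) : |cosine a b| < 1 := by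
  obtain ⟨ha, hb⟩ := ne_zero_of_cross_ne_zero h
  have : 0 < ‖a‖ * ‖b‖ := mul_pos (norm_pos_iff.2 ha) (norm_pos_iff.2 hb)
  rw [cosine, abs_div, abs_of_pos this, div_lt_one this]
  exact abs_inner_lt_of_cross_ne_zero h

lemma inner_eq_cosine {a b : Plane} (h : cross a b ≠ 0) :
    inner ℝ a b = cosine a b * (‖a‖ * ‖b‖) := by
  obtain ⟨ha, hb⟩ := ne_zero_of_cross_ne_zero h
  rw [cosine, div_mul_cancel₀]
  exact mul_ne_zero (norm_ne_zero_iff.2 ha) (norm_ne_zero_iff.2 hb)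

section frame

variable {a b w : Plane} {α β : ℝ}

lemma inner_frame_left (h : cross a b ≠ 0) (hw : w = α • a + β • b) :
    inner ℝ w a = ‖a‖ * (α * ‖a‖ + cosine a b * (β * ‖b‖)) := by
  rw [hw, inner_add_left, real_inner_smul_left, real_inner_smul_left, real_inner_self_eq_norm_sq,
    real_inner_comm, inner_eq_cosine h]
  ring

lemma inner_frame_right (h : cross a b ≠ 0) (hw : w = α • a + β • b) :
    inner ℝ w b = ‖b‖ * (cosine a b * (α * ‖a‖) + β * ‖b‖) := by
  rw [hw, inner_add_left, real_inner_smul_left, real_inner_smul_left, real_inner_self_eq_norm_sq,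
    inner_eq_cosine h]
  ring

lemma norm_sq_frame (h : cross a b ≠ 0) (hw : w = α • a + β • b) :
    ‖w‖ ^ 2 = (α * ‖a‖) ^ 2 + (β * ‖b‖) ^ 2 + 2 * cosine a b * (α * ‖a‖) * (β * ‖b‖) := by
  rw [← real_inner_self_eq_norm_sq]
  nth_rewrite 2 [hw]
  rw [inner_add_right, real_inner_smul_right, real_inner_smul_right, inner_frame_left h hw,
    inner_frame_right h hw]
  ring

/-- A point of the open cone spanned by `a` and `b` that is not inside the unit circle lies beyond
the chord joining the two points of tangency. -/
lemma chord_lt_of_mem_cone (h : cross a b ≠ 0) (hw : w = α • a + β • b) (hα : 0 < α) (hβ : 0 < β)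
    (h1 : 1 ≤ ‖w‖) : 1 + cosine a b < inner ℝ w a / ‖a‖ + inner ℝ w b / ‖b‖ := by
  obtain ⟨ha, hb⟩ := ne_zero_of_cross_ne_zero h
  have ha' := norm_pos_iff.2 ha
  have hb' := norm_pos_iff.2 hb
  obtain ⟨hc1, hc2⟩ := abs_lt.1 (abs_cosine_lt_one h)
  rw [inner_frame_left h hw, inner_frame_right h hw, mul_div_cancel_left₀ _ ha'.ne',
    mul_div_cancel_left₀ _ hb'.ne']
  have hn := norm_sq_frame h hw
  have hx : 0 < α * ‖a‖ := by positivity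
  have hy : 0 < β * ‖b‖ := by positivity
  generalize α * ‖a‖ = x at *
  generalize β * ‖b‖ = y at *
  have hxy : 1 < x + y := by
    have := mul_pos hx hy
    nlinarith
  nlinarith

lemma neg_norm_lt_inner_of_mem_cone (h : cross a b ≠ 0) (hw : w = α • a + β • b) (hα : 0 < α)
    (hβ : 0 < β) (h1 : 1 ≤ ‖w‖) (hb : inner ℝ w b ≤ ‖b‖) : -‖a‖ < inner ℝ w a := by
  obtain ⟨ha0, hb0⟩ := ne_zero_of_cross_ne_zero h
  have := chord_lt_of_mem_cone h hw hα hβ h1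
  have hb' := (div_le_one (norm_pos_iff.2 hb0)).2 hb
  obtain ⟨hc1, hc2⟩ := abs_lt.1 (abs_cosine_lt_one h)
  have h3 : -1 < inner ℝ w a / ‖a‖ := by linarith
  rw [lt_div_iff₀ (norm_pos_iff.2 ha0)] at h3
  linarith

end frame

/-- The part of a corner of the circumscribed hexagon that lies outside the circle, in terms of the
distances `p`, `q` of the projections onto the two unit normals, whose angle has cosine `c`. -/
def cornerSet (c : ℝ) : Set (ℝ × ℝ) :=
  {z | z.1 < 1 ∧ z.2 < 1 ∧ 1 + c < z.1 + z.2 ∧ 1 - c ^ 2 < z.1 ^ 2 + z.2 ^ 2 - 2 * c * z.1 * z.2}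

/-- On the triangle cut off by the chord, the third side of the hexagon is not reached: there the
difference is bounded by its values at the two points of tangency. -/
lemma abs_third_side_lt {A B c d p q : ℝ} (hA : 0 < A) (hB : 0 < B) (hc : 0 < 1 - c ^ 2)
    (hd0 : 0 ≤ d) (hd : d ^ 2 = A ^ 2 + B ^ 2 - 2 * (c * (A * B))) (hp : p < 1) (hq : q < 1)
    (hpq : 1 + c < p + q) : |q * B - p * A| < d := by
  have h1 : B - A * c < d := by
    refine lt_of_pow_lt_pow_left₀ 2 hd0 ?_
    nlinarith [mul_pos (mul_pos hA hA) hc]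
  have h2 : A - B * c < d := by
    refine lt_of_pow_lt_pow_left₀ 2 hd0 ?_
    nlinarith [mul_pos (mul_pos hB hB) hc]
  have h3 : 0 < p - c := by linarith
  have h4 : 0 < q - c := by linarith
  rw [abs_lt]
  constructor <;>
    linarith [mul_pos hB (sub_pos.2 hq), mul_pos hA h3, mul_pos hA (sub_pos.2 hp), mul_pos hB h4]

/-- Within the corner, being outside the circle is preserved by increasing both coordinates. -/
lemma mem_cornerSet_of_le {c : ℝ} (hc : |c| < 1) {x z : ℝ × ℝ} (hx : x ∈ cornerSet c) (hxz : x ≤ z)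
    (h1 : z.1 < 1) (h2 : z.2 < 1) : z ∈ cornerSet c := by
  obtain ⟨x1, x2, x3, x4⟩ := hx
  obtain ⟨l1, l2⟩ := hxz
  obtain ⟨c1, c2⟩ := abs_lt.1 hc
  refine ⟨h1, h2, by linarith, ?_⟩
  have e1 : 0 < x.1 - c * x.2 := by nlinarith
  have e2 : 0 < z.2 - c * z.1 := by nlinarith
  have e3 : 0 < x.2 - c * z.1 := by nlinarith
  have e4 : 0 < z.1 - c * x.2 := by nlinarith
  nlinarith [mul_nonneg (sub_nonneg.2 l1) e1.le, mul_nonneg (sub_nonneg.2 l1) e4.le,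
    mul_nonneg (sub_nonneg.2 l2) e2.le, mul_nonneg (sub_nonneg.2 l2) e3.le]

/-- Two points of a corner are joined through their supremum. -/
lemma isPreconnected_cornerSet {c : ℝ} (hc : |c| < 1) : IsPreconnected (cornerSet c) := by
  refine isPreconnected_of_forall_pair fun x hx y hy => ?_
  have hsup1 : (x ⊔ y).1 < 1 := sup_lt_iff.2 ⟨hx.1, hy.1⟩
  have hsup2 : (x ⊔ y).2 < 1 := sup_lt_iff.2 ⟨hx.2.1, hy.2.1⟩
  refine ⟨Set.Icc x (x ⊔ y) ∪ Set.Icc y (x ⊔ y), ?_, Or.inl ⟨le_rfl, le_sup_left⟩,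
    Or.inr ⟨le_rfl, le_sup_right⟩, ?_⟩
  · rintro z (⟨h1, h2⟩ | ⟨h1, h2⟩)
    · exact mem_cornerSet_of_le hc hx h1 (h2.1.trans_lt hsup1) (h2.2.trans_lt hsup2)
    · exact mem_cornerSet_of_le hc hy h1 (h2.1.trans_lt hsup1) (h2.2.trans_lt hsup2)
  · exact IsPreconnected.union (x ⊔ y) ⟨le_sup_left, le_rfl⟩ ⟨le_sup_right, le_rfl⟩
      (convex_Icc _ _).isPreconnected (convex_Icc _ _).isPreconnected

/-! ### The three corner regions -/

/-- The part of the corner of the hexagon at the dual of the vertex `Rⁱ` that is outside the circle: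
the points of the open hexagon outside the closed unit disc in the open cone spanned by the edges
issuing from `mᵢ`. -/
def corner (m : Fin 3 → Plane) (i : Fin 3) : Set Plane :=
  {w | w ∈ openHexagon m ∧ 1 < ‖w‖ ∧ 0 < weight m (i + 1) w ∧ 0 < weight m (i + 2) w}

/-- The corner together with its two sides and its open arc, but without the tangency points. -/
def closedCorner (m : Fin 3 → Plane) (i : Fin 3) : Set Plane :=
  {w | w ∈ hexagon m ∧ 1 ≤ ‖w‖ ∧ 0 < weight m (i + 1) w ∧ 0 < weight m (i + 2) w}

lemma corner_subset_closedCorner (m : Fin 3 → Plane) (i : Fin 3) : corner m i ⊆ closedCorner m i :=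
  fun _ hw => ⟨openHexagon_subset m hw.1, hw.2.1.le, hw.2.2⟩

lemma isOpen_corner (m : Fin 3 → Plane) (i : Fin 3) : IsOpen (corner m i) :=
  (isOpen_openHexagon m).inter ((isOpen_lt continuous_const continuous_norm).inter
    ((isOpen_lt continuous_const (continuous_weight m _)).inter
      (isOpen_lt continuous_const (continuous_weight m _))))

/-- The pair of range differences with given scaled differences `p`, `q` along the two edges at
`mᵢ`. -/
def cornerPoint (m : Fin 3 → Plane) (i : Fin 3) (z : ℝ × ℝ) : ℝ × ℝ :=
  ![(z.1 * ‖m (i + 1) - m i‖, z.2 * ‖m (i + 2) - m i‖),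
    (-(z.2 * ‖m (i + 2) - m i‖), z.1 * ‖m (i + 1) - m i‖ - z.2 * ‖m (i + 2) - m i‖),
    (z.2 * ‖m (i + 2) - m i‖ - z.1 * ‖m (i + 1) - m i‖, -(z.1 * ‖m (i + 1) - m i‖))] i

lemma continuous_cornerPoint (m : Fin 3 → Plane) (i : Fin 3) : Continuous (cornerPoint m i) := by
  unfold cornerPoint
  fin_cases i <;> simp <;> constructor <;> fun_prop

lemma height_cornerPoint (m : Fin 3 → Plane) (i : Fin 3) (z : ℝ × ℝ) :
    height (cornerPoint m i z) (i + 1) - height (cornerPoint m i z) i = z.1 * ‖m (i + 1) - m i‖ ∧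
    height (cornerPoint m i z) (i + 2) - height (cornerPoint m i z) i = z.2 * ‖m (i + 2) - m i‖ := by
  fin_cases i <;> simp [cornerPoint, height]

lemma cornerPoint_of_height {m : Fin 3 → Plane} {i : Fin 3} {z τ : ℝ × ℝ}
    (h1 : height τ (i + 1) - height τ i = z.1 * ‖m (i + 1) - m i‖)
    (h2 : height τ (i + 2) - height τ i = z.2 * ‖m (i + 2) - m i‖) : cornerPoint m i z = τ := by
  fin_cases i <;> simp [cornerPoint, height] at h1 h2 ⊢ <;> rw [← h1, ← h2] <;> ext <;> simp

/-- A corner of the hexagon outside the circle is a linear image of `cornerSet`. -/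
lemma preimage_corner_eq_image {m : Fin 3 → Plane} (hD : area m ≠ 0) (i : Fin 3) :
    dual m ⁻¹' corner m i =
      cornerPoint m i '' cornerSet (cosine (m (i + 1) - m i) (m (i + 2) - m i)) := by
  have hab : cross (m (i + 1) - m i) (m (i + 2) - m i) ≠ 0 := by rwa [cross_edges]
  obtain ⟨ha, hb⟩ := ne_zero_of_cross_ne_zero hab
  have ha' := norm_pos_iff.2 ha
  have hb' := norm_pos_iff.2 hb
  obtain ⟨hc1, hc2⟩ := abs_lt.1 (abs_cosine_lt_one hab)
  ext τ
  have hw := eq_weight_smul_add hD i (dual m τ)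
  have hl := inner_frame_left hab hw
  have hr := inner_frame_right hab hw
  have hn := norm_sq_frame hab hw
  constructor
  · rintro ⟨h1, h2, h3, h4⟩
    have hch := chord_lt_of_mem_cone hab hw h3 h4 h2.le
    refine ⟨(inner ℝ (dual m τ) (m (i + 1) - m i) / ‖m (i + 1) - m i‖,
      inner ℝ (dual m τ) (m (i + 2) - m i) / ‖m (i + 2) - m i‖), ⟨?_, ?_, hch, ?_⟩, ?_⟩
    · exact (div_lt_one ha').2 ((le_abs_self _).trans_lt (h1 i (i + 1) (by simp)))
    · exact (div_lt_one hb').2 ((le_abs_self _).trans_lt (h1 i (i + 2) (by simp)))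
    · simp only [hl, hr, mul_div_cancel_left₀ _ ha'.ne', mul_div_cancel_left₀ _ hb'.ne']
      have : 1 < ‖dual m τ‖ ^ 2 := by nlinarith
      rw [hn] at this
      generalize weight m (i + 1) (dual m τ) * ‖m (i + 1) - m i‖ = x at *
      generalize weight m (i + 2) (dual m τ) * ‖m (i + 2) - m i‖ = y at *
      have hcc : 0 < 1 - cosine (m (i + 1) - m i) (m (i + 2) - m i) ^ 2 := by nlinarith
      nlinarith
    · apply cornerPoint_of_height
      · rw [div_mul_cancel₀ _ ha'.ne', inner_dual hD]
      · rw [div_mul_cancel₀ _ hb'.ne', inner_dual hD]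
  · rintro ⟨z, ⟨z1, z2, z3, z4⟩, rfl⟩
    have hcp := height_cornerPoint m i z
    rw [← inner_dual hD, ← inner_dual hD] at hcp
    have h3 : inner ℝ (dual m (cornerPoint m i z)) (m (i + 2) - m (i + 1)) =
        z.2 * ‖m (i + 2) - m i‖ - z.1 * ‖m (i + 1) - m i‖ := by
      rw [← hcp.1, ← hcp.2, ← inner_sub_right, sub_sub_sub_cancel_right]
    have hd : ‖m (i + 2) - m (i + 1)‖ ^ 2 = ‖m (i + 1) - m i‖ ^ 2 + ‖m (i + 2) - m i‖ ^ 2 -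
        2 * (cosine (m (i + 1) - m i) (m (i + 2) - m i) *
          (‖m (i + 1) - m i‖ * ‖m (i + 2) - m i‖)) := by
      rw [← inner_eq_cosine hab, ← sub_sub_sub_cancel_right (m (i + 2)) (m (i + 1)) (m i),
        norm_sub_sq_real, real_inner_comm]
      ring
    have hd0 := norm_nonneg (m (i + 2) - m (i + 1))
    rw [hcp.1, mul_comm] at hl
    rw [hcp.2, mul_comm] at hr
    have hl' := mul_left_cancel₀ ha'.ne' hl
    have hr' := mul_left_cancel₀ hb'.ne' hr
    have hcc : 0 < 1 - cosine (m (i + 1) - m i) (m (i + 2) - m i) ^ 2 := by nlinarith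
    refine ⟨mem_openHexagon_of_frame i ?_ ?_ ?_, ?_, ?_, ?_⟩
    · rw [hcp.1, abs_mul, abs_of_pos ha']
      have : |z.1| < 1 := abs_lt.2 ⟨by linarith, z1⟩
      nlinarith
    · rw [hcp.2, abs_mul, abs_of_pos hb']
      have : |z.2| < 1 := abs_lt.2 ⟨by linarith, z2⟩
      nlinarith
    · rw [h3]
      exact abs_third_side_lt ha' hb' hcc hd0 hd z1 z2 z3
    · have : 1 < ‖dual m (cornerPoint m i z)‖ ^ 2 := by
        rw [hn]
        rw [hl', hr'] at z4
        generalize weight m (i + 1) (dual m (cornerPoint m i z)) * ‖m (i + 1) - m i‖ = x at *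
        generalize weight m (i + 2) (dual m (cornerPoint m i z)) * ‖m (i + 2) - m i‖ = y at *
        refine lt_of_mul_lt_mul_left ?_ hcc.le
        linarith
      exact (one_lt_sq_iff₀ (norm_nonneg _)).1 this
    · refine pos_of_mul_pos_left (b := ‖m (i + 1) - m i‖) ?_ ha'.le
      generalize weight m (i + 1) (dual m (cornerPoint m i z)) * ‖m (i + 1) - m i‖ = x at *
      generalize weight m (i + 2) (dual m (cornerPoint m i z)) * ‖m (i + 2) - m i‖ = y at *
      generalize cosine (m (i + 1) - m i) (m (i + 2) - m i) = c at *
      have : 0 < (1 - c ^ 2) * x := by nlinarith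
      exact pos_of_mul_pos_right this hcc.le
    · refine pos_of_mul_pos_left (b := ‖m (i + 2) - m i‖) ?_ hb'.le
      generalize weight m (i + 1) (dual m (cornerPoint m i z)) * ‖m (i + 1) - m i‖ = x at *
      generalize weight m (i + 2) (dual m (cornerPoint m i z)) * ‖m (i + 2) - m i‖ = y at *
      generalize cosine (m (i + 1) - m i) (m (i + 2) - m i) = c at *
      have : 0 < (1 - c ^ 2) * y := by nlinarith
      exact pos_of_mul_pos_right this hcc.le

lemma isPreconnected_preimage_corner {m : Fin 3 → Plane} (hD : area m ≠ 0) (i : Fin 3) :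
    IsPreconnected (dual m ⁻¹' corner m i) := by
  rw [preimage_corner_eq_image hD]
  have hab : cross (m (i + 1) - m i) (m (i + 2) - m i) ≠ 0 := by rwa [cross_edges]
  exact (isPreconnected_cornerSet (abs_cosine_lt_one hab)).image _
    (continuous_cornerPoint m i).continuousOn

/-! ### The hexagon outside the unit disc -/

lemma dual_neg (m : Fin 3 → Plane) (τ : ℝ × ℝ) : dual m (-τ) = -dual m τ := by
  simpa using dual_smul m (-1) τ

lemma height_neg (τ : ℝ × ℝ) (l : Fin 3) : height (-τ) l = -height τ l := by
  fin_cases l <;> simp [height]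

lemma eq_or_eq_succ (i l : Fin 3) : l = i ∨ l = i + 1 ∨ l = i + 2 := by
  revert i l; decide

lemma cross_edge_ne_zero {m : Fin 3 → Plane} {w : Plane} (h : ∀ l, weight m l w ≠ 0) {i j : Fin 3}
    (hij : i ≠ j) : cross w (m j - m i) ≠ 0 := by
  intro h0
  have key : ∃ l, weight m l w = cross w (m j - m i) / area m ∨
      weight m l w = -cross w (m j - m i) / area m := by
    fin_cases i <;> fin_cases j <;> first
      | exact absurd rfl hij
      | exact ⟨0, Or.inl rfl⟩
      | exact ⟨1, Or.inl rfl⟩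
      | exact ⟨2, Or.inl rfl⟩
      | exact ⟨0, Or.inr (by simp [weight, cross]; ring1)⟩
      | exact ⟨1, Or.inr (by simp [weight, cross]; ring1)⟩
      | exact ⟨2, Or.inr (by simp [weight, cross]; ring1)⟩
  obtain ⟨l, hl | hl⟩ := key <;> exact h l (by rw [hl, h0]; simp)

lemma weight_ne_zero_of_mem_closedCorner {m : Fin 3 → Plane} {i : Fin 3} {w : Plane}
    (hw : w ∈ closedCorner m i) (l : Fin 3) : weight m l w ≠ 0 := by
  obtain ⟨-, -, h1, h2⟩ := hw
  have := weight_sum m i w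
  have h0 : weight m i w ≠ 0 := by linarith
  rcases eq_or_eq_succ i l with rfl | rfl | rfl
  · exact h0
  · exact h1.ne'
  · exact h2.ne'

/-- On the unit circle, the sides of the hexagon are met only at the points of tangency. -/
lemma mem_openHexagon_of_norm_eq_one {m : Fin 3 → Plane} {w : Plane} (h : ∀ l, weight m l w ≠ 0)
    (h1 : ‖w‖ = 1) : w ∈ openHexagon m := fun i j hij => by
  simpa [h1] using abs_inner_lt_of_cross_ne_zero (cross_edge_ne_zero h hij)

lemma eq_unit_of_weight_eq_zero {m : Fin 3 → Plane} (hD : area m ≠ 0) {w : Plane}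
    (hw : w ∈ hexagon m) (h1 : 1 ≤ ‖w‖) {l : Fin 3} (hl : weight m l w = 0) :
    ∃ i j, i ≠ j ∧ w = ‖m j - m i‖⁻¹ • (m j - m i) := by
  have hne : l + 1 ≠ l + 2 := by simp
  have hpos := edge_norm_pos hD hne
  have he := eq_weight_smul_add hD (l + 2) w
  have e1 : l + 2 + 1 = l := (by decide : ∀ l : Fin 3, l + 2 + 1 = l) l
  have e2 : l + 2 + 2 = l + 1 := (by decide : ∀ l : Fin 3, l + 2 + 2 = l + 1) l
  rw [e1, e2, hl, zero_smul, zero_add] at he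
  generalize weight m (l + 1) w = t at he
  have hw' := hw (l + 2) (l + 1)
  rw [norm_sub_rev] at hpos
  rw [he, real_inner_smul_left, real_inner_self_eq_norm_sq, abs_mul, abs_of_nonneg (sq_nonneg ‖_‖)]
    at hw'
  rw [he, norm_smul, Real.norm_eq_abs] at h1
  have ht : |t| = ‖m (l + 1) - m (l + 2)‖⁻¹ := by
    apply eq_inv_of_mul_eq_one_left
    refine le_antisymm ?_ h1
    refine le_of_mul_le_mul_right ?_ hpos
    linarith [hw', pow_two ‖m (l + 1) - m (l + 2)‖]
  rcases abs_choice t with h | h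
  · exact ⟨l + 2, l + 1, hne.symm, by rw [he, ← ht, h]⟩
  · refine ⟨l + 1, l + 2, hne, ?_⟩
    rw [he, norm_sub_rev, ← ht, h, neg_smul, ← smul_neg, neg_sub]

/-- The hexagon outside the open unit disc consists of the three corners, their opposites and the
points of tangency: among three weights with sum zero, two have the same sign or one vanishes. -/
lemma mem_hexagon_cases {m : Fin 3 → Plane} (hD : area m ≠ 0) {w : Plane} (hw : w ∈ hexagon m)
    (h1 : 1 ≤ ‖w‖) : (∃ i, w ∈ closedCorner m i) ∨ (∃ i, -w ∈ closedCorner m i) ∨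
      ∃ i j, i ≠ j ∧ w = ‖m j - m i‖⁻¹ • (m j - m i) := by
  by_cases h : ∃ l, weight m l w = 0
  · obtain ⟨l, hl⟩ := h
    exact Or.inr (Or.inr (eq_unit_of_weight_eq_zero hD hw h1 hl))
  push Not at h
  have hpos : ∀ i, 0 < weight m (i + 1) w → 0 < weight m (i + 2) w → w ∈ closedCorner m i :=
    fun i h2 h3 => ⟨hw, h1, h2, h3⟩
  have hneg : ∀ i, weight m (i + 1) w < 0 → weight m (i + 2) w < 0 → -w ∈ closedCorner m i :=
    fun i h2 h3 => ⟨neg_mem_hexagon hw, by rwa [norm_neg], by rw [weight_neg]; linarith,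
      by rw [weight_neg]; linarith⟩
  rcases lt_or_gt_of_ne (h 0) with h0 | h0 <;> rcases lt_or_gt_of_ne (h 1) with h1 | h1 <;>
    rcases lt_or_gt_of_ne (h 2) with h2 | h2
  · exact Or.inr (Or.inl ⟨0, hneg 0 h1 h2⟩)
  · exact Or.inr (Or.inl ⟨2, hneg 2 h0 h1⟩)
  · exact Or.inr (Or.inl ⟨1, hneg 1 h2 h0⟩)
  · exact Or.inl ⟨0, hpos 0 h1 h2⟩
  · exact Or.inr (Or.inl ⟨0, hneg 0 h1 h2⟩)
  · exact Or.inl ⟨1, hpos 1 h2 h0⟩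
  · exact Or.inl ⟨2, hpos 2 h0 h1⟩
  · exact Or.inl ⟨0, hpos 0 h1 h2⟩

lemma preimage_closedCorner_subset_closure {m : Fin 3 → Plane} (hD : area m ≠ 0) (i : Fin 3) :
    dual m ⁻¹' closedCorner m i ⊆ closure (dual m ⁻¹' corner m i) := by
  intro τ hτ
  have hne := weight_ne_zero_of_mem_closedCorner hτ
  obtain ⟨hw, h1, h2, h3⟩ := hτ
  have hcont : Continuous fun t : ℝ => t • τ := by fun_prop
  have hdual : ∀ t : ℝ, 0 < t → t • dual m τ ∈ openHexagon m → 1 < t * ‖dual m τ‖ →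
      t • τ ∈ dual m ⁻¹' corner m i := by
    intro t ht h4 h5
    rw [Set.mem_preimage, dual_smul]
    refine ⟨h4, by rwa [norm_smul, Real.norm_eq_abs, abs_of_pos ht], ?_, ?_⟩
    · rw [weight_smul]; exact mul_pos ht h2
    · rw [weight_smul]; exact mul_pos ht h3
  rcases h1.lt_or_eq with h1 | h1
  · -- outside the circle, approach by contracting
    have hlim : Filter.Tendsto (fun t : ℝ => t • τ) (nhdsWithin 1 (Set.Iio 1)) (nhds τ) := by
      simpa using (hcont.tendsto 1).mono_left nhdsWithin_le_nhds
    refine mem_closure_of_tendsto hlim ?_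
    have h4 : ∀ᶠ t : ℝ in nhds 1, 1 < t * ‖dual m τ‖ :=
      (continuous_id.mul continuous_const).tendsto' 1 _ rfl |>.eventually_const_lt (by simpa using h1)
    filter_upwards [nhdsWithin_le_nhds h4, nhdsWithin_le_nhds (lt_mem_nhds one_pos),
      self_mem_nhdsWithin] with t ht1 ht2 ht3
    exact hdual t ht2 (smul_mem_openHexagon hD hw ht2.le ht3) ht1
  · -- on the circle, approach by dilating
    have hlim : Filter.Tendsto (fun t : ℝ => t • τ) (nhdsWithin 1 (Set.Ioi 1)) (nhds τ) := by
      simpa using (hcont.tendsto 1).mono_left nhdsWithin_le_nhds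
    refine mem_closure_of_tendsto hlim ?_
    have h4 : ∀ᶠ t : ℝ in nhds 1, t • dual m τ ∈ openHexagon m := by
      have hc : Continuous fun t : ℝ => t • dual m τ := by fun_prop
      refine hc.continuousAt.eventually_mem ((isOpen_openHexagon m).mem_nhds ?_)
      simpa using mem_openHexagon_of_norm_eq_one hne h1.symm
    filter_upwards [nhdsWithin_le_nhds h4, self_mem_nhdsWithin] with t ht1 ht2
    have ht2 : 1 < t := ht2
    exact hdual t (by linarith) ht1 (by rw [← h1]; linarith)

lemma closure_preimage_corner_subset {m : Fin 3 → Plane} (i : Fin 3) :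
    closure (dual m ⁻¹' corner m i) ⊆ {τ | dual m τ ∈ hexagon m ∧ 1 ≤ ‖dual m τ‖ ∧
      0 ≤ weight m (i + 1) (dual m τ) ∧ 0 ≤ weight m (i + 2) (dual m τ)} := by
  refine closure_minimal ?_ ?_
  · rintro τ ⟨h1, h2, h3, h4⟩
    exact ⟨openHexagon_subset m h1, h2.le, h3.le, h4.le⟩
  · have hd := continuous_dual m
    exact ((isClosed_hexagon m).preimage hd).inter ((isClosed_le continuous_const hd.norm).inter
      ((isClosed_le continuous_const ((continuous_weight m _).comp hd)).inter
        (isClosed_le continuous_const ((continuous_weight m _).comp hd))))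

/-! ### Sources with signed distances -/

/-- The point `x` has distances `|r + τₗ|` from the microphones. When all `r + τₗ` are nonnegative,
`x` is a source with range differences `τ`. -/
def IsSignedSource (m : Fin 3 → Plane) (τ : ℝ × ℝ) (x : Plane) (r : ℝ) : Prop :=
  ∀ l, ‖x - m l‖ ^ 2 = (r + height τ l) ^ 2

lemma tdoaMap_eq_iff (m : Fin 3 → Plane) (τ : ℝ × ℝ) (x : Plane) :
    tdoaMap m x = τ ↔ ∃ r, IsSignedSource m τ x r ∧ ∀ l, 0 ≤ r + height τ l := by
  constructor
  · rintro rfl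
    have : ∀ l, ‖x - m 0‖ + height (tdoaMap m x) l = ‖x - m l‖ := by
      intro l; fin_cases l <;> simp [height, tdoaMap]
    exact ⟨‖x - m 0‖, fun l => by rw [this], fun l => by rw [this]; positivity⟩
  · rintro ⟨r, h1, h2⟩
    have : ∀ l, ‖x - m l‖ = r + height τ l := fun l =>
      (pow_left_inj₀ (norm_nonneg _) (h2 l) two_ne_zero).1 (h1 l)
    simp [tdoaMap, this, height]

namespace IsSignedSource

variable {m : Fin 3 → Plane} {τ : ℝ × ℝ} {x : Plane} {r : ℝ}

lemma abs_eq (h : IsSignedSource m τ x r) (l : Fin 3) : ‖x - m l‖ = |r + height τ l| := by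
  rw [← abs_of_nonneg (norm_nonneg (x - m l))]
  exact (sq_eq_sq_iff_abs_eq_abs _ _).1 (h l)

lemma neg (h : IsSignedSource m τ x r) : IsSignedSource m (-τ) x (-r) := by
  intro l
  rw [h l, height_neg]; ring

/-- Signed distances of different sign differ by at least the length of the edge. -/
lemma nonneg_of_nonneg (h : IsSignedSource m τ x r) {i j : Fin 3}
    (hij : -‖m j - m i‖ < height τ j - height τ i) (hi : 0 ≤ r + height τ i) :
    0 ≤ r + height τ j := by
  by_contra! hj
  have h1 := h.abs_eq i
  have h2 := h.abs_eq j
  rw [abs_of_nonneg hi] at h1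
  rw [abs_of_neg hj] at h2
  have h3 := norm_sub_le (x - m i) (x - m j)
  rw [sub_sub_sub_cancel_left] at h3
  linarith

lemma nonneg_of_mem_openHexagon (hD : area m ≠ 0) (h : IsSignedSource m τ x r)
    (hw : dual m τ ∈ openHexagon m) {i : Fin 3} (hi : 0 ≤ r + height τ i) (j : Fin 3) :
    0 ≤ r + height τ j := by
  rcases eq_or_ne i j with rfl | hij
  · exact hi
  · refine h.nonneg_of_nonneg ?_ hi
    rw [← inner_dual hD]
    exact (abs_lt.1 (hw i j hij)).1

lemma two_mul_inner (hD : area m ≠ 0) (h : IsSignedSource m τ x r) (i j : Fin 3) :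
    2 * inner ℝ (x - m i) (m j - m i) = ‖m j - m i‖ ^ 2 -
      2 * (r + height τ i) * inner ℝ (dual m τ) (m j - m i) -
        inner ℝ (dual m τ) (m j - m i) ^ 2 := by
  have h1 := h j
  rw [← sub_sub_sub_cancel_right x (m j) (m i), norm_sub_sq_real, h i] at h1
  have h2 := inner_dual hD τ i j
  have h3 : r + height τ j = r + height τ i + inner ℝ (dual m τ) (m j - m i) := by
    rw [h2]; ring
  rw [h3] at h1
  linarith

/-- In the corner at `mᵢ` the signed distance from `mᵢ` is nonnegative. With `z = x - mᵢ` and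
`s = r + τᵢ`, the inner product of `z` with the dual coordinate `w` is at least `-s ‖w‖²`, so that
for `s < 0` the Cauchy-Schwarz inequality `⟪z, w⟫ ≤ |s| ‖w‖` contradicts `1 ≤ ‖w‖`. -/
lemma nonneg_vertex_of_mem_closedCorner (hD : area m ≠ 0) (h : IsSignedSource m τ x r)
    {i : Fin 3} (hw : dual m τ ∈ closedCorner m i) : 0 ≤ r + height τ i := by
  by_contra! hs
  have hne := weight_ne_zero_of_mem_closedCorner hw
  obtain ⟨hx, h1, ha, hb⟩ := hw
  have e1 := h.two_mul_inner hD i (i + 1)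
  have e2 := h.two_mul_inner hD i (i + 2)
  have hz := h.abs_eq i
  rw [abs_of_neg hs] at hz
  have hCS := real_inner_le_norm (x - m i) (dual m τ)
  have hw := eq_weight_smul_add hD i (dual m τ)
  have hzw := congrArg (fun v => inner ℝ (x - m i) v) hw
  have hww := congrArg (fun v => inner ℝ (dual m τ) v) hw
  simp only [inner_add_right, real_inner_smul_right] at hzw hww
  rw [real_inner_self_eq_norm_sq] at hww
  rw [hz] at hCS
  have b1 := sq_le_sq' (abs_le.1 (hx i (i + 1))).1 (abs_le.1 (hx i (i + 1))).2
  have b2 := sq_le_sq' (abs_le.1 (hx i (i + 2))).1 (abs_le.1 (hx i (i + 2))).2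
  have key : 2 * inner ℝ (x - m i) (dual m τ) =
      weight m (i + 1) (dual m τ) *
        (‖m (i + 1) - m i‖ ^ 2 - inner ℝ (dual m τ) (m (i + 1) - m i) ^ 2) +
      weight m (i + 2) (dual m τ) *
        (‖m (i + 2) - m i‖ ^ 2 - inner ℝ (dual m τ) (m (i + 2) - m i) ^ 2) -
      2 * (r + height τ i) * ‖dual m τ‖ ^ 2 := by
    linear_combination 2 * hzw + weight m (i + 1) (dual m τ) * e1 +
      weight m (i + 2) (dual m τ) * e2 + 2 * (r + height τ i) * hww
  have t1 := mul_nonneg ha.le (sub_nonneg.2 b1)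
  have t2 := mul_nonneg hb.le (sub_nonneg.2 b2)
  rcases h1.lt_or_eq with h1 | h1
  · have : 0 < -(r + height τ i) * (‖dual m τ‖ * (‖dual m τ‖ - 1)) := by
      refine mul_pos (by linarith) (mul_pos (by linarith) (by linarith))
    nlinarith
  · have hlt := (mem_openHexagon_of_norm_eq_one hne h1.symm) i (i + 1) (by simp)
    have b1' := sq_lt_sq' (abs_lt.1 hlt).1 (abs_lt.1 hlt).2
    have t1' := mul_pos ha (sub_pos.2 b1')
    rw [← h1] at key hCS
    linarith

lemma nonneg_of_mem_closedCorner (hD : area m ≠ 0) (h : IsSignedSource m τ x r)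
    {i : Fin 3} (hw : dual m τ ∈ closedCorner m i) (l : Fin 3) : 0 ≤ r + height τ l := by
  have hi := h.nonneg_vertex_of_mem_closedCorner hD hw
  obtain ⟨hx, h1, ha, hb⟩ := hw
  have hab : cross (m (i + 1) - m i) (m (i + 2) - m i) ≠ 0 := by rwa [cross_edges]
  have hba : cross (m (i + 2) - m i) (m (i + 1) - m i) ≠ 0 := by
    contrapose! hab; rw [cross] at hab ⊢; linarith
  have hw := eq_weight_smul_add hD i (dual m τ)
  rcases eq_or_eq_succ i l with rfl | rfl | rfl
  · exact hi
  · refine h.nonneg_of_nonneg ?_ hi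
    rw [← inner_dual hD]
    exact neg_norm_lt_inner_of_mem_cone hab hw ha hb h1 (abs_le.1 (hx i (i + 2))).2
  · refine h.nonneg_of_nonneg ?_ hi
    rw [← inner_dual hD]
    rw [add_comm] at hw
    exact neg_norm_lt_inner_of_mem_cone hba hw hb ha h1 (abs_le.1 (hx i (i + 1))).2

lemma dual_mem_hexagon (hD : area m ≠ 0) (h : IsSignedSource m τ x r)
    (hr : ∀ l, 0 ≤ r + height τ l) : dual m τ ∈ hexagon m := by
  intro i j
  rw [inner_dual hD]
  have h1 := abs_norm_sub_norm_le (x - m j) (x - m i)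
  rwa [h.abs_eq, h.abs_eq, abs_of_nonneg (hr j), abs_of_nonneg (hr i), sub_sub_sub_cancel_left,
    norm_sub_rev, add_sub_add_left_eq_sub] at h1

/-- Opposite a corner all signed distances are nonpositive. -/
lemma not_nonneg_of_neg_mem_closedCorner (hD : area m ≠ 0) (h : IsSignedSource m τ x r)
    {i : Fin 3} (hw : -dual m τ ∈ closedCorner m i) : ¬ ∀ l, 0 ≤ r + height τ l := by
  intro hr
  rw [← dual_neg] at hw
  have h0 : ∀ l, x = m l := by
    intro l
    have h1 := h.neg.nonneg_of_mem_closedCorner hD hw l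
    rw [height_neg] at h1
    have h2 := h.abs_eq l
    rw [le_antisymm (by linarith) (hr l), abs_zero, norm_eq_zero, sub_eq_zero] at h2
    exact h2
  apply hD
  rw [area, ← h0 0, ← h0 1]
  simp [cross]

/-- At a point of tangency the signed distances from the ends of one edge put `x` on the line of that
edge, and then the signed distance from the third microphone is inconsistent. -/
lemma false_of_dual_eq_unit (hD : area m ≠ 0) (h : IsSignedSource m τ x r)
    {i j : Fin 3} (hij : i ≠ j) (hw : dual m τ = ‖m j - m i‖⁻¹ • (m j - m i)) : False := by
  have hpos := edge_norm_pos hD hij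
  obtain ⟨k, hk⟩ : ∃ k, cross (m j - m i) (m k - m i) ≠ 0 := by
    have h1 := cross_edges m i
    rcases (eq_or_eq_succ i j).resolve_left hij.symm with rfl | rfl
    · exact ⟨i + 2, by rwa [h1]⟩
    · refine ⟨i + 1, fun h2 => hD ?_⟩
      rw [← h1]; rw [cross] at h2 ⊢; linarith
  have hwn : ‖dual m τ‖ = 1 := by
    rw [hw, norm_smul, norm_inv, norm_norm, inv_mul_cancel₀ hpos.ne']
  have hwe : inner ℝ (dual m τ) (m j - m i) = ‖m j - m i‖ := by
    rw [hw, real_inner_smul_left, real_inner_self_eq_norm_sq]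
    field_simp
  have e1 := h.two_mul_inner hD i j
  have e2 := h.two_mul_inner hD i k
  have hzw : inner ℝ (x - m i) (dual m τ) = -(r + height τ i) := by
    rw [hwe] at e1
    rw [hw, real_inner_smul_right]
    field_simp
    linarith
  -- equality in the Cauchy-Schwarz inequality puts `x` on the line of the edge
  have hz : x - m i + (r + height τ i) • dual m τ = 0 := by
    rw [← norm_eq_zero, ← sq_eq_zero_iff, norm_add_sq_real, real_inner_smul_right, hzw, h i,
      norm_smul, hwn, Real.norm_eq_abs, mul_one, sq_abs]
    ring
  rw [eq_neg_of_add_eq_zero_left hz, inner_neg_left, real_inner_smul_left] at e2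
  have hlt : |inner ℝ (dual m τ) (m k - m i)| < ‖m k - m i‖ := by
    have : cross (dual m τ) (m k - m i) ≠ 0 := by
      have h3 : cross (dual m τ) (m k - m i) =
          ‖m j - m i‖⁻¹ * cross (m j - m i) (m k - m i) := by
        rw [hw]; simp [cross]; ring
      rw [h3]
      exact mul_ne_zero (inv_ne_zero hpos.ne') hk
    simpa [hwn] using abs_inner_lt_of_cross_ne_zero this
  have := sq_lt_sq' (abs_lt.1 hlt).1 (abs_lt.1 hlt).2
  linarith

end IsSignedSource

/-! ### The quadratic equation for the distance from the reference microphone -/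

/-- The point `q` with `⟪q, d₁₀⟫ = Q₁₀ / 2` and `⟪q, d₂₀⟫ = Q₂₀ / 2`: a source at signed distance `r`
from `m₀` is `m₀ + q - r w`. -/
def foot (m : Fin 3 → Plane) (τ : ℝ × ℝ) : Plane :=
  dual m (minkSq m τ 1 0 / 2, minkSq m τ 2 0 / 2)

lemma inner_foot {m : Fin 3 → Plane} (hD : area m ≠ 0) (τ : ℝ × ℝ) :
    inner ℝ (foot m τ) (m 1 - m 0) = minkSq m τ 1 0 / 2 ∧
      inner ℝ (foot m τ) (m 2 - m 0) = minkSq m τ 2 0 / 2 := by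
  rw [foot, inner_dual hD, inner_dual hD]
  simp [height]

lemma isSignedSource_iff {m : Fin 3 → Plane} (hD : area m ≠ 0) {τ : ℝ × ℝ} {x : Plane} {r : ℝ} :
    IsSignedSource m τ x r ↔ x = m 0 + foot m τ - r • dual m τ ∧
      (‖dual m τ‖ ^ 2 - 1) * r ^ 2 - 2 * inner ℝ (foot m τ) (dual m τ) * r + ‖foot m τ‖ ^ 2 = 0 := by
  obtain ⟨f1, f2⟩ := inner_foot hD τ
  have d1 := inner_dual hD τ 0 1
  have d2 := inner_dual hD τ 0 2
  have hn : ‖foot m τ - r • dual m τ‖ ^ 2 =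
      ‖foot m τ‖ ^ 2 - 2 * inner ℝ (foot m τ) (dual m τ) * r + ‖dual m τ‖ ^ 2 * r ^ 2 := by
    rw [norm_sub_sq_real, real_inner_smul_right, norm_smul, Real.norm_eq_abs, mul_pow, sq_abs]
    ring
  constructor
  · intro h
    have hx : x - m 0 = foot m τ - r • dual m τ := by
      have e1 := h.two_mul_inner hD 0 1
      have e2 := h.two_mul_inner hD 0 2
      apply eq_of_inner_edges_eq hD
      · rw [inner_sub_left (foot m τ), real_inner_smul_left, f1, minkSq, disp]
        rw [← d1]
        simp only [height, Matrix.cons_val_zero, add_zero] at e1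
        linarith
      · rw [inner_sub_left (foot m τ), real_inner_smul_left, f2, minkSq, disp]
        rw [← d2]
        simp only [height, Matrix.cons_val_zero, add_zero] at e2
        linarith
    have h0 := h 0
    rw [hx, hn] at h0
    simp only [height, Matrix.cons_val_zero, add_zero] at h0
    exact ⟨by rw [add_sub_assoc, ← hx]; simp, by linarith⟩
  · rintro ⟨rfl, h⟩
    have hx : m 0 + foot m τ - r • dual m τ - m 0 = foot m τ - r • dual m τ := by abel
    have h0 : ‖m 0 + foot m τ - r • dual m τ - m 0‖ ^ 2 = r ^ 2 := by
      rw [hx, hn]; linarith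
    have step : ∀ l, inner ℝ (foot m τ) (m l - m 0) = minkSq m τ l 0 / 2 →
        ‖m 0 + foot m τ - r • dual m τ - m l‖ ^ 2 = (r + height τ l) ^ 2 := by
      intro l hl
      rw [← sub_sub_sub_cancel_right _ (m l) (m 0), norm_sub_sq_real, h0, hx, inner_sub_left,
        real_inner_smul_left, hl, inner_dual hD, minkSq, disp]
      simp only [height, Matrix.cons_val_zero]
      ring
    intro l
    fin_cases l
    · simpa [height] using h0
    · exact step 1 f1
    · exact step 2 f2

/-- The discriminant of the quadratic equation is, up to a positive factor, the product of the three
Minkowski squares that define the polygon. -/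
lemma discriminant_eq {m : Fin 3 → Plane} (hD : area m ≠ 0) (τ : ℝ × ℝ) :
    inner ℝ (foot m τ) (dual m τ) ^ 2 - (‖dual m τ‖ ^ 2 - 1) * ‖foot m τ‖ ^ 2 =
      minkSq m τ 1 0 * minkSq m τ 2 0 * minkSq m τ 2 1 / (4 * area m ^ 2) := by
  obtain ⟨f1, f2⟩ := inner_foot hD τ
  have d1 := inner_dual hD τ 0 1
  have d2 := inner_dual hD τ 0 2
  have d3 := inner_dual hD τ 1 2
  generalize foot m τ = q at *
  generalize dual m τ = w at *
  have hL := lagrange_identity q w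
  have e1 : area m * cross q w = inner ℝ q (m 1 - m 0) * inner ℝ w (m 2 - m 0) -
      inner ℝ q (m 2 - m 0) * inner ℝ w (m 1 - m 0) := by
    simp only [inner_eq_coord, area, cross]; ring
  have e2 : area m ^ 2 * ‖q‖ ^ 2 = inner ℝ q (m 1 - m 0) ^ 2 * ‖m 2 - m 0‖ ^ 2 +
      inner ℝ q (m 2 - m 0) ^ 2 * ‖m 1 - m 0‖ ^ 2 -
      2 * inner ℝ q (m 1 - m 0) * inner ℝ q (m 2 - m 0) * inner ℝ (m 1 - m 0) (m 2 - m 0) := by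
    simp only [inner_eq_coord, norm_sq_eq_coord, area, cross]; ring
  have e3 : ‖m 2 - m 1‖ ^ 2 = ‖m 2 - m 0‖ ^ 2 - 2 * inner ℝ (m 1 - m 0) (m 2 - m 0) +
      ‖m 1 - m 0‖ ^ 2 := by
    rw [← sub_sub_sub_cancel_right (m 2) (m 1) (m 0), norm_sub_sq_real, real_inner_comm]
  have hg : inner ℝ q w ^ 2 - (‖w‖ ^ 2 - 1) * ‖q‖ ^ 2 = ‖q‖ ^ 2 - cross q w ^ 2 := by linarith
  rw [hg, eq_div_iff (by positivity)]
  have hA : (‖q‖ ^ 2 - cross q w ^ 2) * (4 * area m ^ 2) =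
      4 * (area m ^ 2 * ‖q‖ ^ 2) - 4 * (area m * cross q w) ^ 2 := by ring
  rw [hA, e1, e2, f1, f2, d1, d2]
  simp only [minkSq, disp, e3, height, Matrix.cons_val_zero, Matrix.cons_val_one, Matrix.cons_val,
    sub_zero]
  ring

lemma coeffB_eq {m : Fin 3 → Plane} (hD : area m ≠ 0) (τ : ℝ × ℝ) :
    coeffB m τ = |area m| * inner ℝ (foot m τ) (dual m τ) := by
  obtain ⟨f1, f2⟩ := inner_foot hD τ
  have d1 := inner_dual hD τ 0 1
  have d2 := inner_dual hD τ 0 2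
  simp only [height, Matrix.cons_val_zero, Matrix.cons_val_one, Matrix.cons_val, sub_zero] at d1 d2
  have g1 : minkSq m τ 1 0 = 2 * inner ℝ (foot m τ) (m 1 - m 0) := by rw [f1]; ring
  have g2 : minkSq m τ 2 0 = 2 * inner ℝ (foot m τ) (m 2 - m 0) := by rw [f2]; ring
  have hw : wedgeNorm (disp m 1 0) (disp m 2 0) = |area m| := rfl
  rw [coeffB, hw, div_eq_iff (by positivity), g1, g2, ← d1, ← d2]
  have : |area m| * inner ℝ (foot m τ) (dual m τ) * (2 * |area m|) =
      2 * area m ^ 2 * inner ℝ (foot m τ) (dual m τ) := by rw [← sq_abs (area m)]; ring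
  rw [this]
  simp only [inner_eq_coord, area, cross, disp, PiLp.sub_apply, PiLp.smul_apply, smul_eq_mul]
  ring

lemma discriminant_pos {m : Fin 3 → Plane} (hD : area m ≠ 0) {τ : ℝ × ℝ}
    (hw : dual m τ ∈ openHexagon m) :
    0 < inner ℝ (foot m τ) (dual m τ) ^ 2 - (‖dual m τ‖ ^ 2 - 1) * ‖foot m τ‖ ^ 2 := by
  have h : ∀ i j, i ≠ j → 0 < minkSq m τ j i := by
    intro i j hij
    rw [minkSq, disp, ← inner_dual hD]
    exact sub_pos.2 (sq_lt_sq' (abs_lt.1 (hw i j hij)).1 (abs_lt.1 (hw i j hij)).2)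
  rw [discriminant_eq hD]
  have h1 := h 0 1 (by decide)
  have h2 := h 0 2 (by decide)
  have h3 := h 1 2 (by decide)
  positivity

lemma discriminant_eq_zero {m : Fin 3 → Plane} (hD : area m ≠ 0) {τ : ℝ × ℝ}
    (hw : dual m τ ∈ hexagon m) (hw' : dual m τ ∉ openHexagon m) :
    inner ℝ (foot m τ) (dual m τ) ^ 2 - (‖dual m τ‖ ^ 2 - 1) * ‖foot m τ‖ ^ 2 = 0 := by
  simp only [openHexagon, Set.mem_ofPred_eq, not_forall, not_lt] at hw'
  obtain ⟨i, j, hij, h⟩ := hw'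
  have h0 : minkSq m τ j i = 0 := by
    rw [minkSq, disp, ← inner_dual hD, ← sq_abs (inner ℝ _ _), le_antisymm (hw i j) h, sub_self]
  have symm : minkSq m τ i j = 0 := by
    rw [← h0, minkSq, minkSq, disp, disp, norm_sub_rev]; ring
  rw [discriminant_eq hD]
  fin_cases i <;> fin_cases j <;> first
    | exact absurd rfl hij
    | (simp only [Fin.zero_eta, Fin.mk_one, Fin.reduceFinMk] at h0 symm; simp [h0]; done)
    | (simp only [Fin.zero_eta, Fin.mk_one, Fin.reduceFinMk] at h0 symm; simp [symm])

lemma foot_ne_zero {m : Fin 3 → Plane} (hD : area m ≠ 0) {τ : ℝ × ℝ}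
    (hw : dual m τ ∈ openHexagon m) : foot m τ ≠ 0 := by
  intro h
  simpa [h] using discriminant_pos hD hw

/-! ### Counting the sources -/

/-- The admissible distances of a source from the reference microphone. -/
def admissible (m : Fin 3 → Plane) (τ : ℝ × ℝ) : Set ℝ :=
  {r | (‖dual m τ‖ ^ 2 - 1) * r ^ 2 - 2 * inner ℝ (foot m τ) (dual m τ) * r + ‖foot m τ‖ ^ 2 = 0 ∧
    ∀ l, 0 ≤ r + height τ l}

lemma ncard_fiber {m : Fin 3 → Plane} (hD : area m ≠ 0) (τ : ℝ × ℝ) :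
    (tdoaMap m ⁻¹' {τ}).ncard = (admissible m τ).ncard := by
  have : tdoaMap m ⁻¹' {τ} =
      (fun r : ℝ => m 0 + foot m τ - r • dual m τ) '' admissible m τ := by
    ext x
    rw [Set.mem_preimage, Set.mem_singleton_iff, tdoaMap_eq_iff]
    constructor
    · rintro ⟨r, h1, h2⟩
      obtain ⟨h3, h4⟩ := (isSignedSource_iff hD).1 h1
      exact ⟨r, ⟨h4, h2⟩, h3.symm⟩
    · rintro ⟨r, ⟨h1, h2⟩, rfl⟩
      exact ⟨r, (isSignedSource_iff hD).2 ⟨rfl, h1⟩, h2⟩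
  rw [this, Set.InjOn.ncard_image]
  rintro r ⟨h1, h2⟩ s ⟨h3, h4⟩ hrs
  have a1 := (isSignedSource_iff hD).2 ⟨rfl, h1⟩ 0
  have a2 := (isSignedSource_iff hD).2 ⟨rfl, h3⟩ 0
  simp only at hrs
  rw [hrs, a2] at a1
  have := (pow_left_inj₀ (h4 0) (h2 0) two_ne_zero).1 a1
  linarith

lemma quadratic_eq_zero_iff_sq {A B C r : ℝ} (hA : A ≠ 0) :
    A * r ^ 2 - 2 * B * r + C = 0 ↔ (A * r - B) ^ 2 = B ^ 2 - A * C := by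
  constructor
  · intro h; linear_combination A * h
  · intro h
    refine mul_left_cancel₀ hA ?_
    linear_combination h

lemma ncard_fiber_of_norm_lt_one {m : Fin 3 → Plane} (hD : area m ≠ 0) {τ : ℝ × ℝ}
    (hw : ‖dual m τ‖ < 1) : (tdoaMap m ⁻¹' {τ}).ncard = 1 := by
  have hhex := mem_openHexagon_of_norm_lt_one hD hw
  have hd := discriminant_pos hD hhex
  have hq : 0 < ‖foot m τ‖ ^ 2 := by have := foot_ne_zero hD hhex; positivity
  have hA : ‖dual m τ‖ ^ 2 - 1 < 0 := by nlinarith [norm_nonneg (dual m τ)]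
  rw [ncard_fiber hD, Set.ncard_eq_one]
  have h0 : ∀ r ∈ admissible m τ, 0 ≤ r := fun r hr => by simpa [height] using hr.2 0
  have hs := Real.sq_sqrt hd.le
  have hs0 := Real.sqrt_nonneg
    (inner ℝ (foot m τ) (dual m τ) ^ 2 - (‖dual m τ‖ ^ 2 - 1) * ‖foot m τ‖ ^ 2)
  set s := √(inner ℝ (foot m τ) (dual m τ) ^ 2 - (‖dual m τ‖ ^ 2 - 1) * ‖foot m τ‖ ^ 2)
  have hBs : inner ℝ (foot m τ) (dual m τ) < s := by
    refine lt_of_pow_lt_pow_left₀ 2 hs0 ?_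
    rw [hs]; nlinarith
  have hroot : (inner ℝ (foot m τ) (dual m τ) - s) / (‖dual m τ‖ ^ 2 - 1) ∈ admissible m τ := by
    have heq : (‖dual m τ‖ ^ 2 - 1) *
        ((inner ℝ (foot m τ) (dual m τ) - s) / (‖dual m τ‖ ^ 2 - 1)) ^ 2 -
        2 * inner ℝ (foot m τ) (dual m τ) *
          ((inner ℝ (foot m τ) (dual m τ) - s) / (‖dual m τ‖ ^ 2 - 1)) + ‖foot m τ‖ ^ 2 = 0 := by
      rw [quadratic_eq_zero_iff_sq hA.ne, mul_div_cancel₀ _ hA.ne, ← hs]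
      ring
    refine ⟨heq, ((isSignedSource_iff hD).2 ⟨rfl, heq⟩).nonneg_of_mem_openHexagon hD hhex (i := 0) ?_⟩
    simp only [height, Matrix.cons_val_zero, add_zero]
    exact div_nonneg_of_nonpos (by linarith) hA.le
  refine ⟨_, Set.eq_singleton_iff_unique_mem.2 ⟨hroot, fun r hr => ?_⟩⟩
  generalize (inner ℝ (foot m τ) (dual m τ) - s) / (‖dual m τ‖ ^ 2 - 1) = t at hroot
  by_contra hne
  -- distinct roots have the negative product `C / A`
  have hp : (‖dual m τ‖ ^ 2 - 1) * (r * t) = ‖foot m τ‖ ^ 2 := by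
    refine mul_left_cancel₀ (sub_ne_zero.2 hne) ?_
    linear_combination t * hr.1 - r * hroot.1
  nlinarith [mul_nonneg (h0 r hr) (h0 t hroot)]

lemma admissible_of_mem_closedCorner {m : Fin 3 → Plane} (hD : area m ≠ 0) {τ : ℝ × ℝ}
    {i : Fin 3} (hw : dual m τ ∈ closedCorner m i) : admissible m τ = {r : ℝ |
      (‖dual m τ‖ ^ 2 - 1) * r ^ 2 - 2 * inner ℝ (foot m τ) (dual m τ) * r +
        ‖foot m τ‖ ^ 2 = 0} := by
  ext r
  exact ⟨fun h => h.1, fun h =>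
    ⟨h, ((isSignedSource_iff hD).2 ⟨rfl, h⟩).nonneg_of_mem_closedCorner hD hw⟩⟩

lemma ncard_fiber_of_mem_corner {m : Fin 3 → Plane} (hD : area m ≠ 0) {τ : ℝ × ℝ} {i : Fin 3}
    (hw : dual m τ ∈ corner m i) : (tdoaMap m ⁻¹' {τ}).ncard = 2 := by
  have hd := discriminant_pos hD hw.1
  have hA : ‖dual m τ‖ ^ 2 - 1 ≠ 0 := by nlinarith [hw.2.1]
  rw [ncard_fiber hD, admissible_of_mem_closedCorner hD (corner_subset_closedCorner m i hw)]
  simp only [quadratic_eq_zero_iff_sq hA]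
  generalize inner ℝ (foot m τ) (dual m τ) = B at *
  have hs := Real.sq_sqrt hd.le
  have hs0 := Real.sqrt_pos.2 hd
  set s := √(B ^ 2 - (‖dual m τ‖ ^ 2 - 1) * ‖foot m τ‖ ^ 2)
  generalize ‖dual m τ‖ ^ 2 - 1 = A at *
  rw [Set.ncard_eq_two]
  refine ⟨(B + s) / A, (B - s) / A, ?_, ?_⟩
  · rw [Ne, div_left_inj' hA]; linarith
  · ext r
    rw [Set.mem_ofPred_eq, ← hs, sq_eq_sq_iff_eq_or_eq_neg, Set.mem_insert_iff,
      Set.mem_singleton_iff, eq_div_iff hA, eq_div_iff hA]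
    constructor <;> rintro (h | h)
    · left; linarith
    · right; linarith
    · left; linarith
    · right; linarith

lemma ncard_fiber_of_mem_closedCorner_diff {m : Fin 3 → Plane} (hD : area m ≠ 0) {τ : ℝ × ℝ}
    {i : Fin 3} (hw : dual m τ ∈ closedCorner m i) (hw' : dual m τ ∉ corner m i) :
    (tdoaMap m ⁻¹' {τ}).ncard = 1 := by
  have hne := weight_ne_zero_of_mem_closedCorner hw
  rw [ncard_fiber hD, admissible_of_mem_closedCorner hD hw, Set.ncard_eq_one]
  rcases hw.2.1.lt_or_eq with h1 | h1
  · -- on a side of the polygon there is a double root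
    have hA : ‖dual m τ‖ ^ 2 - 1 ≠ 0 := by nlinarith
    have hd := discriminant_eq_zero hD hw.1 fun h => hw' ⟨h, h1, hw.2.2⟩
    refine ⟨inner ℝ (foot m τ) (dual m τ) / (‖dual m τ‖ ^ 2 - 1), ?_⟩
    ext r
    rw [Set.mem_ofPred_eq, quadratic_eq_zero_iff_sq hA, hd, Set.mem_singleton_iff, eq_div_iff hA,
      sq_eq_zero_iff, sub_eq_zero, mul_comm]
  · -- on the ellipse the equation is linear
    have hd := discriminant_pos hD (mem_openHexagon_of_norm_eq_one hne h1.symm)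
    rw [← h1, one_pow, sub_self, zero_mul, sub_zero] at hd
    rw [← h1]
    have hB : inner ℝ (foot m τ) (dual m τ) ≠ 0 := fun h => by simp [h] at hd
    refine ⟨‖foot m τ‖ ^ 2 / (2 * inner ℝ (foot m τ) (dual m τ)), ?_⟩
    ext r
    rw [Set.mem_ofPred_eq, Set.mem_singleton_iff, eq_div_iff (by positivity)]
    constructor <;> intro h <;> linarith

/-- The range of the TDOA map, in the dual plane: the open disc and the three corners. -/
lemma mem_range_iff {m : Fin 3 → Plane} (hD : area m ≠ 0) {τ : ℝ × ℝ} :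
    τ ∈ Set.range (tdoaMap m) ↔ ‖dual m τ‖ < 1 ∨ ∃ i, dual m τ ∈ closedCorner m i := by
  constructor
  · rintro ⟨x, hx⟩
    obtain ⟨r, h1, h2⟩ := (tdoaMap_eq_iff m τ x).1 hx
    by_cases hn : ‖dual m τ‖ < 1
    · exact Or.inl hn
    rcases mem_hexagon_cases hD (h1.dual_mem_hexagon hD h2) (not_lt.1 hn) with
      h | ⟨i, h⟩ | ⟨i, j, hij, h⟩
    · exact Or.inr h
    · exact absurd h2 (h1.not_nonneg_of_neg_mem_closedCorner hD h)
    · exact (h1.false_of_dual_eq_unit hD hij h).elim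
  · intro h
    have hn : (tdoaMap m ⁻¹' {τ}).ncard ≠ 0 := by
      rcases h with h | ⟨i, h⟩
      · rw [ncard_fiber_of_norm_lt_one hD h]; norm_num
      · by_cases h' : dual m τ ∈ corner m i
        · rw [ncard_fiber_of_mem_corner hD h']; norm_num
        · rw [ncard_fiber_of_mem_closedCorner_diff hD h h']; norm_num
    obtain ⟨x, hx⟩ := Set.nonempty_of_ncard_ne_zero hn
    exact ⟨x, hx⟩

/-! ### Vertices and points of tangency -/

lemma vertex_eq_cornerPoint (m : Fin 3 → Plane) (i : Fin 3) :
    vertex m i = cornerPoint m i (1, 1) := by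
  fin_cases i <;> simp [vertex, cornerPoint, disp, norm_sub_rev (m 0)]
  simp [norm_sub_rev (m 1) (m 2)]

lemma dual_vertex_mem_closedCorner {m : Fin 3 → Plane} (hD : area m ≠ 0) (i : Fin 3) :
    dual m (vertex m i) ∈ closedCorner m i := by
  have hab : cross (m (i + 1) - m i) (m (i + 2) - m i) ≠ 0 := by rwa [cross_edges]
  obtain ⟨ha, hb⟩ := ne_zero_of_cross_ne_zero hab
  have ha' := norm_pos_iff.2 ha
  have hb' := norm_pos_iff.2 hb
  obtain ⟨hc1, hc2⟩ := abs_lt.1 (abs_cosine_lt_one hab)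
  have hcp := height_cornerPoint m i (1, 1)
  simp only [one_mul, ← vertex_eq_cornerPoint, ← inner_dual hD] at hcp
  obtain ⟨h1, h2⟩ := hcp
  have hw := eq_weight_smul_add hD i (dual m (vertex m i))
  have hl := inner_frame_left hab hw
  have hr := inner_frame_right hab hw
  rw [h1] at hl
  rw [h2] at hr
  have hl' := (mul_right_eq_self₀.1 hl.symm).resolve_right ha'.ne'
  have hr' := (mul_right_eq_self₀.1 hr.symm).resolve_right hb'.ne'
  have h3 : inner ℝ (dual m (vertex m i)) (m (i + 2) - m (i + 1)) =
      ‖m (i + 2) - m i‖ - ‖m (i + 1) - m i‖ := by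
    rw [← h1, ← h2, ← inner_sub_right, sub_sub_sub_cancel_right]
  have h3' : |inner ℝ (dual m (vertex m i)) (m (i + 2) - m (i + 1))| ≤
      ‖m (i + 2) - m (i + 1)‖ := by
    rw [h3]
    refine (abs_norm_sub_norm_le _ _).trans_eq ?_
    rw [sub_sub_sub_cancel_right]
  have h1' : |inner ℝ (dual m (vertex m i)) (m (i + 1) - m i)| ≤ ‖m (i + 1) - m i‖ := by
    rw [h1, abs_norm]
  have h2' : |inner ℝ (dual m (vertex m i)) (m (i + 2) - m i)| ≤ ‖m (i + 2) - m i‖ := by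
    rw [h2, abs_norm]
  refine ⟨mem_hexagon_of_frame i h1' h2' h3', ?_, ?_, ?_⟩
  · have := real_inner_le_norm (dual m (vertex m i)) (m (i + 1) - m i)
    rw [h1] at this
    exact le_of_mul_le_mul_right (by linarith) ha'
  · refine pos_of_mul_pos_left (b := ‖m (i + 1) - m i‖) ?_ ha'.le
    generalize weight m (i + 1) (dual m (vertex m i)) * ‖m (i + 1) - m i‖ = x at *
    generalize weight m (i + 2) (dual m (vertex m i)) * ‖m (i + 2) - m i‖ = y at *
    generalize cosine (m (i + 1) - m i) (m (i + 2) - m i) = c at *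
    have : (1 + c) * x = 1 := by
      refine mul_left_cancel₀ (sub_pos.2 hc2).ne' ?_
      linear_combination hl' - c * hr'
    exact pos_of_mul_pos_right (this ▸ one_pos) (by linarith)
  · refine pos_of_mul_pos_left (b := ‖m (i + 2) - m i‖) ?_ hb'.le
    generalize weight m (i + 1) (dual m (vertex m i)) * ‖m (i + 1) - m i‖ = x at *
    generalize weight m (i + 2) (dual m (vertex m i)) * ‖m (i + 2) - m i‖ = y at *
    generalize cosine (m (i + 1) - m i) (m (i + 2) - m i) = c at *
    have : (1 + c) * y = 1 := by
      refine mul_left_cancel₀ (sub_pos.2 hc2).ne' ?_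
      linear_combination hr' - c * hl'
    exact pos_of_mul_pos_right (this ▸ one_pos) (by linarith)

lemma dual_tangencyAlong {m : Fin 3 → Plane} (hD : area m ≠ 0) (j k : Fin 3) :
    dual m (tangencyAlong m j k) = ‖m j - m k‖⁻¹ • (m j - m k) := by
  rw [← dual_inner hD (‖m j - m k‖⁻¹ • (m j - m k)), tangencyAlong, real_inner_comm,
    real_inner_comm _ (disp m 2 0)]
  rfl

lemma mem_tangencyPoints_iff {m : Fin 3 → Plane} (hD : area m ≠ 0) {τ : ℝ × ℝ} :
    τ ∈ tangencyPoints m ↔ ∃ i j, i ≠ j ∧ dual m τ = ‖m j - m i‖⁻¹ • (m j - m i) := by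
  have hneg : ∀ j k, dual m (-tangencyAlong m j k) = ‖m k - m j‖⁻¹ • (m k - m j) := by
    intro j k
    rw [dual_neg, dual_tangencyAlong hD, norm_sub_rev, ← smul_neg, neg_sub]
  constructor
  · rintro ⟨i, rfl | rfl⟩ <;> fin_cases i
    · exact ⟨1, 2, by decide, dual_tangencyAlong hD 2 1⟩
    · exact ⟨0, 2, by decide, dual_tangencyAlong hD 2 0⟩
    · exact ⟨0, 1, by decide, dual_tangencyAlong hD 1 0⟩
    · exact ⟨2, 1, by decide, hneg 2 1⟩
    · exact ⟨2, 0, by decide, hneg 2 0⟩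
    · exact ⟨1, 0, by decide, hneg 1 0⟩
  · rintro ⟨i, j, hij, h⟩
    have h1 : τ = tangencyAlong m j i :=
      dual_injective hD (h.trans (dual_tangencyAlong hD j i).symm)
    have h2 : τ = -tangencyAlong m i j := dual_injective hD (h.trans (hneg i j).symm)
    fin_cases i <;> fin_cases j <;> first
      | exact absurd rfl hij
      | exact ⟨0, Or.inl h1⟩
      | exact ⟨1, Or.inl h1⟩
      | exact ⟨2, Or.inl h1⟩
      | exact ⟨0, Or.inr h2⟩
      | exact ⟨1, Or.inr h2⟩
      | exact ⟨2, Or.inr h2⟩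

/-! ### The connected components of the ambiguous region -/

/-- The component of `int(P₂) ∩ E⁺ ∩ C⁺` at the vertex `Rⁱ`. -/
def region (m : Fin 3 → Plane) (i : Fin 3) : Set (ℝ × ℝ) := dual m ⁻¹' corner m i

lemma isOpen_region (m : Fin 3 → Plane) (i : Fin 3) : IsOpen (region m i) :=
  (isOpen_corner m i).preimage (continuous_dual m)

lemma coeffA_neg_iff {m : Fin 3 → Plane} (hD : area m ≠ 0) {τ : ℝ × ℝ} :
    coeffA m τ < 0 ↔ ‖dual m τ‖ < 1 := by
  have h : 0 < area m ^ 2 := by positivity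
  rw [coeffA_eq hD, ← sq_lt_one_iff₀ (norm_nonneg (dual m τ))]
  constructor <;> intro h' <;> nlinarith

lemma coeffA_pos_iff {m : Fin 3 → Plane} (hD : area m ≠ 0) {τ : ℝ × ℝ} :
    0 < coeffA m τ ↔ 1 < ‖dual m τ‖ := by
  have h : 0 < area m ^ 2 := by positivity
  rw [coeffA_eq hD, ← one_lt_sq_iff₀ (norm_nonneg (dual m τ)), mul_pos_iff_of_pos_left h, sub_pos]

lemma coeffB_pos_iff {m : Fin 3 → Plane} (hD : area m ≠ 0) {τ : ℝ × ℝ} :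
    0 < coeffB m τ ↔ 0 < inner ℝ (foot m τ) (dual m τ) := by
  rw [coeffB_eq hD, mul_pos_iff_of_pos_left (abs_pos.2 hD)]

/-- The cubic `b` is positive exactly on the three corners at the vertices `Rⁱ`: its sign is the
common sign of the roots of the quadratic equation, hence of all signed distances. -/
lemma ambiguous_eq_iUnion {m : Fin 3 → Plane} (hD : area m ≠ 0) :
    ambiguous m = ⋃ i, region m i := by
  ext τ
  rw [Set.mem_iUnion]
  change (τ ∈ interior (polygon m) ∧ 0 < coeffA m τ) ∧ 0 < coeffB m τ ↔ _
  rw [mem_interior_polygon_iff hD, coeffA_pos_iff hD, coeffB_pos_iff hD]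
  constructor
  · rintro ⟨⟨h1, h2⟩, h3⟩
    rcases mem_hexagon_cases hD (openHexagon_subset m h1) h2.le with
      ⟨i, h⟩ | ⟨i, h⟩ | ⟨i, j, hij, h⟩
    · exact ⟨i, h1, h2, h.2.2⟩
    · exfalso
      have hd := discriminant_pos hD h1
      have hA : 0 < ‖dual m τ‖ ^ 2 - 1 := by nlinarith
      have heq := (quadratic_eq_zero_iff_sq (B := inner ℝ (foot m τ) (dual m τ))
        (C := ‖foot m τ‖ ^ 2) (r := (inner ℝ (foot m τ) (dual m τ) +
          √(inner ℝ (foot m τ) (dual m τ) ^ 2 - (‖dual m τ‖ ^ 2 - 1) * ‖foot m τ‖ ^ 2)) /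
            (‖dual m τ‖ ^ 2 - 1)) hA.ne').2 (by
          rw [mul_div_cancel₀ _ hA.ne', add_sub_cancel_left, Real.sq_sqrt hd.le])
      have hsrc := (isSignedSource_iff hD).2 ⟨rfl, heq⟩
      refine hsrc.not_nonneg_of_neg_mem_closedCorner hD h
        (hsrc.nonneg_of_mem_openHexagon hD h1 (i := 0) ?_)
      simp only [height, Matrix.cons_val_zero, add_zero]
      positivity
    · rw [h, norm_smul, norm_inv, norm_norm, inv_mul_cancel₀ (edge_norm_pos hD hij).ne'] at h2
      exact absurd h2 (lt_irrefl _)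
  · rintro ⟨i, h⟩
    refine ⟨⟨h.1, h.2.1⟩, ?_⟩
    have hd := discriminant_pos hD h.1
    have hA : 0 < ‖dual m τ‖ ^ 2 - 1 := by nlinarith [h.2.1]
    have heq := (quadratic_eq_zero_iff_sq (B := inner ℝ (foot m τ) (dual m τ))
      (C := ‖foot m τ‖ ^ 2) (r := (inner ℝ (foot m τ) (dual m τ) -
        √(inner ℝ (foot m τ) (dual m τ) ^ 2 - (‖dual m τ‖ ^ 2 - 1) * ‖foot m τ‖ ^ 2)) /
          (‖dual m τ‖ ^ 2 - 1)) hA.ne').2 (by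
        rw [mul_div_cancel₀ _ hA.ne', sub_sub_cancel_left, neg_sq, Real.sq_sqrt hd.le])
    have h0 := ((isSignedSource_iff hD).2 ⟨rfl, heq⟩).nonneg_of_mem_closedCorner hD
      (corner_subset_closedCorner m i h) 0
    simp only [height, Matrix.cons_val_zero, add_zero] at h0
    have := (le_div_iff₀ hA).1 h0
    linarith [Real.sqrt_pos.2 hd]

lemma disjoint_region (m : Fin 3 → Plane) {i j : Fin 3} (hij : i ≠ j) :
    Disjoint (region m i) (region m j) := by
  rw [Set.disjoint_left]
  rintro τ ⟨-, -, h1, h2⟩ ⟨-, -, h3, h4⟩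
  have := weight_sum m i (dual m τ)
  rcases (eq_or_eq_succ i j).resolve_left hij.symm with rfl | rfl
  · have e : i + 1 + 2 = i := (by decide : ∀ i : Fin 3, i + 1 + 2 = i) i
    rw [e] at h4
    linarith
  · have e : i + 2 + 1 = i := (by decide : ∀ i : Fin 3, i + 2 + 1 = i) i
    rw [e] at h3
    linarith

lemma connectedComponentIn_ambiguous {m : Fin 3 → Plane} (hD : area m ≠ 0) {i : Fin 3}
    {τ : ℝ × ℝ} (hτ : τ ∈ region m i) : connectedComponentIn (ambiguous m) τ = region m i := by
  have hsub : region m i ⊆ ambiguous m := by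
    rw [ambiguous_eq_iUnion hD]; exact Set.subset_iUnion _ i
  refine Set.Subset.antisymm ?_
    ((isPreconnected_preimage_corner hD i).subset_connectedComponentIn hτ hsub)
  refine IsPreconnected.subset_left_of_subset_union (isOpen_region m i)
    (isOpen_iUnion fun j => isOpen_iUnion fun _ : i ≠ j => isOpen_region m j) ?_ ?_
    ⟨τ, mem_connectedComponentIn (hsub hτ), hτ⟩ isPreconnected_connectedComponentIn
  · simp only [Set.disjoint_iUnion_right]
    exact fun j hij => disjoint_region m hij
  · refine (connectedComponentIn_subset _ _).trans ?_
    rw [ambiguous_eq_iUnion hD]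
    refine Set.iUnion_subset fun j => ?_
    rcases eq_or_ne i j with rfl | hij
    · exact Set.subset_union_left
    · exact (Set.subset_iUnion₂ (s := fun j (_ : i ≠ j) => region m j) j hij).trans
        Set.subset_union_right

lemma vertex_mem_closure_region {m : Fin 3 → Plane} (hD : area m ≠ 0) (i : Fin 3) :
    vertex m i ∈ closure (region m i) :=
  preimage_closedCorner_subset_closure hD i (dual_vertex_mem_closedCorner hD i)

lemma region_nonempty {m : Fin 3 → Plane} (hD : area m ≠ 0) (i : Fin 3) : (region m i).Nonempty :=
  closure_nonempty_iff.1 ⟨_, vertex_mem_closure_region hD i⟩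

/-- The weight of `mᵢ` is negative at `Rⁱ` but nonnegative on the closures of the other two
regions. -/
lemma eq_of_vertex_mem_closure_region {m : Fin 3 → Plane} (hD : area m ≠ 0) {i j : Fin 3}
    (h : vertex m i ∈ closure (region m j)) : i = j := by
  by_contra hij
  obtain ⟨-, -, h1, h2⟩ := closure_preimage_corner_subset j h
  obtain ⟨-, -, h3, h4⟩ := dual_vertex_mem_closedCorner hD i
  have := weight_sum m i (dual m (vertex m i))
  rcases (eq_or_eq_succ j i).resolve_left hij with rfl | rfl <;> linarith

lemma components_ambiguous {m : Fin 3 → Plane} (hD : area m ≠ 0) :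
    components (ambiguous m) = Set.range (region m) := by
  ext W
  constructor
  · rintro ⟨τ, hτ, rfl⟩
    rw [ambiguous_eq_iUnion hD, Set.mem_iUnion] at hτ
    obtain ⟨i, hi⟩ := hτ
    exact ⟨i, (connectedComponentIn_ambiguous hD hi).symm⟩
  · rintro ⟨i, rfl⟩
    obtain ⟨τ, hτ⟩ := region_nonempty hD i
    refine ⟨τ, ?_, (connectedComponentIn_ambiguous hD hτ).symm⟩
    rw [ambiguous_eq_iUnion hD]
    exact Set.mem_iUnion.2 ⟨i, hτ⟩

lemma isComponentLabelling_iff {m : Fin 3 → Plane} (hD : area m ≠ 0) {U : Fin 3 → Set (ℝ × ℝ)} :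
    IsComponentLabelling m U ↔ U = region m := by
  constructor
  · intro h
    funext i
    have : U i ∈ Set.range (region m) := by
      rw [← components_ambiguous hD, ← h.range_eq]; exact ⟨i, rfl⟩
    obtain ⟨j, hj⟩ := this
    have hv := h.vertex_mem i
    rw [← hj] at hv ⊢
    rw [eq_of_vertex_mem_closure_region hD hv]
  · rintro rfl
    refine ⟨fun i j hij => ?_, (components_ambiguous hD).symm, vertex_mem_closure_region hD⟩
    by_contra hne
    have hdis := disjoint_region m hne
    rw [hij, disjoint_self] at hdis
    exact (region_nonempty hD j).ne_empty hdis

lemma range_tdoaMap_eq {m : Fin 3 → Plane} (hD : area m ≠ 0) :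
    Set.range (tdoaMap m) =
      (ellipseMinus m ∪ ⋃ i, closure (region m i)) \ tangencyPoints m := by
  ext τ
  rw [Set.mem_sdiff, Set.mem_union, Set.mem_iUnion, mem_tangencyPoints_iff hD]
  change _ ↔ (coeffA m τ < 0 ∨ _) ∧ _
  rw [coeffA_neg_iff hD]
  constructor
  · intro h
    refine ⟨((mem_range_iff hD).1 h).imp_right fun ⟨i, hi⟩ =>
      ⟨i, preimage_closedCorner_subset_closure hD i hi⟩, ?_⟩
    rintro ⟨i, j, hij, hu⟩
    obtain ⟨x, hx⟩ := h
    obtain ⟨r, h1, h2⟩ := (tdoaMap_eq_iff m τ x).1 hx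
    exact h1.false_of_dual_eq_unit hD hij hu
  · rintro ⟨h, hu⟩
    refine (mem_range_iff hD).2 (h.imp_right fun ⟨i, hi⟩ => ⟨i, ?_⟩)
    obtain ⟨h1, h2, h3, h4⟩ := closure_preimage_corner_subset i hi
    refine ⟨h1, h2, h3.lt_of_ne fun h0 => hu ?_, h4.lt_of_ne fun h0 => hu ?_⟩
    · exact eq_unit_of_weight_eq_zero hD h1 h2 h0.symm
    · exact eq_unit_of_weight_eq_zero hD h1 h2 h0.symm

end TDOA
end

theorem mainTheorem1 (m : Fin 3 → TDOA.Plane) (hm : ¬ Collinear ℝ (Set.range m)) :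
    (∃! U : Fin 3 → Set (ℝ × ℝ), TDOA.IsComponentLabelling m U) ∧
    ∀ U : Fin 3 → Set (ℝ × ℝ), TDOA.IsComponentLabelling m U →
      Set.range (TDOA.tdoaMap m) =
          (TDOA.ellipseMinus m ∪ closure (U 0) ∪ closure (U 1) ∪ closure (U 2)) \
            TDOA.tangencyPoints m ∧
        (∀ τ ∈ U 0 ∪ U 1 ∪ U 2, (TDOA.tdoaMap m ⁻¹' {τ}).ncard = 2) ∧
        (∀ τ ∈ Set.range (TDOA.tdoaMap m) \ (U 0 ∪ U 1 ∪ U 2),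
          (TDOA.tdoaMap m ⁻¹' {τ}).ncard = 1) := by
  have hD := TDOA.area_ne_zero hm
  refine ⟨⟨TDOA.region m, (TDOA.isComponentLabelling_iff hD).2 rfl,
    fun U hU => (TDOA.isComponentLabelling_iff hD).1 hU⟩, fun U hU => ?_⟩
  obtain rfl := (TDOA.isComponentLabelling_iff hD).1 hU
  have hunion : ∀ V : Fin 3 → Set (ℝ × ℝ), ⋃ i, V i = V 0 ∪ V 1 ∪ V 2 := by
    intro V
    ext τ
    simp [Fin.exists_fin_succ, or_assoc]
  refine ⟨?_, ?_, ?_⟩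
  · rw [TDOA.range_tdoaMap_eq hD, hunion fun i => closure (TDOA.region m i), ← Set.union_assoc,
      ← Set.union_assoc]
  · intro τ hτ
    rw [← hunion, Set.mem_iUnion] at hτ
    obtain ⟨i, hi⟩ := hτ
    exact TDOA.ncard_fiber_of_mem_corner hD hi
  · rintro τ ⟨hτ, hτ'⟩
    rw [← hunion, Set.mem_iUnion, not_exists] at hτ'
    rcases (TDOA.mem_range_iff hD).1 hτ with h | ⟨i, h⟩
    · exact TDOA.ncard_fiber_of_norm_lt_one hD h
    · exact TDOA.ncard_fiber_of_mem_closedCorner_diff hD h (hτ' i)
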